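/- Let $H_1,H_2,U$ be (real or complex) Hilbert spaces, $U$ identified with its dual, and let $A_i:H_i\supseteq D(A_i)\to H_i$, $i=1,2$, be (strictly) positive self-adjoint operators: $\langle A_i x,x\rangle\ge m_i\|x\|^2$ for all $x\in D(A_i)$, with some $m_i>0$. Put $H_{i,1}=D(A_i)$, let $H_{i,1/2}=D(A_i^{1/2})$ with norm $\|A_i^{1/2}x\|$, and let $H_{i,-1/2}$ be the dual of $H_{i,1/2}$, with $H_i$ as pivot space; $A_i$ extends to a bounded operator $H_{i,1/2}\to H_{i,-1/2}$. Let $B:U\to H_{1,-1/2}$ be bounded, with adjoint $B^*:H_{1,1/2}\to U$, and let $C:H_2\supseteq D(C)\to H_1$ be a linear operator with continuous embeddings (for the graph norms) $H_{2,1/2}\hookrightarrow D(C)$ and $H_{1,1/2}\hookrightarrow D(C^*)$. (i) For every $\lambda>0$, the operator $\lambda^2+A_1+\lambda^2C(\lambda^2+A_2)^{-1}C^*$ is invertible from $H_{1,1/2}$ to $H_{1,-1/2}$, that is, it is a bounded bijection with bounded inverse. (ii) For $\lambda>0$ let $G(\lambda)=\lambda B^*\,[\lambda^2+A_1+\lambda^2C(\lambda^2+A_2)^{-1}C^*]^{-1}B\in\mathcal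 L(U)$. Then $G$ is the transfer function, on $\lambda>0$, of both of the following systems. (a) The coupled system $\ddot w_1+A_1w_1+BB^*\dot w_1+C\dot w_2=0$, $\ddot w_2+A_2w_2-C^*\dot w_1=0$. Its open loop system has input $u$ and output $y=B^*\dot w_1$, and reads $\ddot w_1+A_1w_1+C\dot w_2=Bu$, $\ddot w_2+A_2w_2-C^*\dot w_1=0$. Its generator is $\mathcal A_1^0(u_1,v_1,u_2,v_2)=(u_2,\,v_2,\,-A_1u_1-Cv_2,\,-A_2v_1+C^*u_2)$, its control operator is $u\mapsto(0,0,Bu,0)$ and its observation is $(u_1,v_1,u_2,v_2)\mapsto B^*u_2$. (b) The second order system $\ddot W+AW+\mathcal B_0\mathcal B_0^*\dot W=0$ in $H=H_1\times H_2$. Here $A$ is the positive self-adjoint operator $A(u,v)=\big(A_1u+C(C^*u+A_2^{1/2}v),\,A_2^{1/2}(C^*u+A_2^{1/2}v)\big)$ with domain $D(A)=\{(u,v)\in H_{1,1}\times H_{2,1/2}: C^*u+A_2^{1/2}v\in H_{2,1/2}\}$, and $\mathcal B_0=(B,0)^{\top}:U\to D(A^{1/2})^*$, so that $\mathcal B_0^*(x,y)=B^*x$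 for $(x,y)\in D(A^{1/2})$. Its open loop system is $\ddot W+AW=\mathcal B_0u$, $y=\mathcal B_0^*\dot W$, with generator $\mathcal A_2^0(x,y)=(y,-Ax)$, control operator $u\mapsto(0,\mathcal B_0u)$ and observation $(x,y)\mapsto\mathcal B_0^*y$. The transfer function of an open loop system with generator $\mathcal A$, control operator $\mathcal B$ and observation $\mathcal B^*$ is $\lambda\mapsto\mathcal B^*(\lambda-\mathcal A)^{-1}\mathcal B$. In it, $\lambda-\mathcal A$ is extended to a bounded operator from $H_{1,1/2}\times H_{2,1/2}\times H_{1,1/2}\times H_{2,1/2}$ to $H_{1,1/2}\times H_{2,1/2}\times H_{1,-1/2}\times H_{2,-1/2}$ in case (a), and from $D(A^{1/2})\times D(A^{1/2})$ to $D(A^{1/2})\times D(A^{1/2})^*$ in case (b). These extensions are boundedly invertible for every $\lambda>0$, and both transfer functions are equal to $G(\lambda)$. -/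

import Mathlib

noncomputable section

namespace CoupledWave

variable {𝕜 : Type*} [RCLike 𝕜]
variable {H : Type*} [NormedAddCommGroup H] [InnerProductSpace 𝕜 H] [CompleteSpace H]
variable {K : Type*} [NormedAddCommGroup K] [InnerProductSpace 𝕜 K] [CompleteSpace K]

/-! ### Self-adjoint unbounded operators -/

section SelfAdjoint

lemma selfAdj_symm {T : H →ₗ.[𝕜] H} (hT : IsSelfAdjoint T) (x y : T.domain) :
    inner 𝕜 (T x) (y : H) = inner 𝕜 (x : H) (T y) := by
  have h := LinearPMap.adjoint_isFormalAdjoint hT.dense_domain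
  rw [LinearPMap.isSelfAdjoint_def.mp hT] at h
  exact h x y

lemma selfAdj_mem {T : H →ₗ.[𝕜] H} (hT : IsSelfAdjoint T) (y w : H)
    (h : ∀ x : T.domain, inner 𝕜 w (x : H) = inner 𝕜 y (T x)) :
    ∃ hy : y ∈ T.domain, T ⟨y, hy⟩ = w := by
  have h1 : y ∈ T.adjoint.domain := LinearPMap.mem_adjoint_domain_of_exists y ⟨w, h⟩
  have h2 := LinearPMap.adjoint_apply_eq hT.dense_domain ⟨y, h1⟩ h
  have h3 : T.adjoint = T := LinearPMap.isSelfAdjoint_def.mp hT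
  have h4 : y ∈ T.domain := by rw [← h3]; exact h1
  refine ⟨h4, ?_⟩
  rw [← h2]
  exact h3.ge.2 rfl

lemma dense_of_symm_surj {T : H →ₗ.[𝕜] H}
    (hs : ∀ x y : T.domain, inner 𝕜 (T x) (y : H) = inner 𝕜 (x : H) (T y))
    (hsurj : ∀ f : H, ∃ x : T.domain, T x = f) : Dense (T.domain : Set H) := by
  rw [Submodule.dense_iff_topologicalClosure_eq_top,
    Submodule.topologicalClosure_eq_top_iff, Submodule.eq_bot_iff]
  intro y hy
  obtain ⟨z, rfl⟩ := hsurj y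
  have h0 : ∀ x : T.domain, inner 𝕜 (z : H) (T x) = 0 := fun x => by
    rw [← hs z x, ← inner_conj_symm, (Submodule.mem_orthogonal _ _).mp hy x x.2, map_zero]
  obtain ⟨x, hx⟩ := hsurj z
  have h1 : (z : H) = 0 := by
    have := h0 x
    rw [hx] at this
    exact inner_self_eq_zero.mp this
  have : z = 0 := by ext; exact h1
  rw [this, LinearPMap.map_zero]

/-- A symmetric surjective operator is self-adjoint. -/
lemma isSelfAdjoint_of_symm_surj {T : H →ₗ.[𝕜] H}
    (hs : ∀ x y : T.domain, inner 𝕜 (T x) (y : H) = inner 𝕜 (x : H) (T y))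
    (hsurj : ∀ f : H, ∃ x : T.domain, T x = f) : IsSelfAdjoint T := by
  have hd := dense_of_symm_surj hs hsurj
  rw [LinearPMap.isSelfAdjoint_def]
  have hle : T ≤ T.adjoint := LinearPMap.IsFormalAdjoint.le_adjoint hd hs
  refine (LinearPMap.eq_of_le_of_domain_eq hle ?_).symm
  refine le_antisymm hle.1 fun y hy => ?_
  obtain ⟨x, hx⟩ := hsurj (T.adjoint ⟨y, hy⟩)
  have h1 : ∀ z : T.domain, inner 𝕜 (y - x) (T z) = 0 := fun z => by
    rw [inner_sub_left, ← hs x z, hx,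
      LinearPMap.adjoint_isFormalAdjoint hd ⟨y, hy⟩ z, sub_self]
  obtain ⟨z, hz⟩ := hsurj (y - x)
  have h2 : y - x = 0 := by
    have := h1 z
    rw [hz] at this
    exact inner_self_eq_zero.mp this
  rw [sub_eq_zero.mp h2]
  exact x.2

end SelfAdjoint

/-- A positive self-adjoint (unbounded) operator on a Hilbert space; positivity is strict,
`⟨A x, x⟩ ≥ m ‖x‖²` with some `m > 0`. -/
structure PosOp (𝕜 : Type*) [RCLike 𝕜] (H : Type*) [NormedAddCommGroup H]
    [InnerProductSpace 𝕜 H] [CompleteSpace H] where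
  op : H →ₗ.[𝕜] H
  selfAdj : IsSelfAdjoint op
  bddBelow : ∃ m : ℝ, 0 < m ∧
    ∀ x : op.domain, m * ‖(x : H)‖ ^ 2 ≤ RCLike.re (inner 𝕜 (op x) (x : H))

/-- `S` is the (unique) positive square root of `A`: `S` is self-adjoint, nonnegative and `S ∘ S = A`
(with equality of domains). -/
structure IsPosSqrt (S A : H →ₗ.[𝕜] H) : Prop where
  selfAdj : IsSelfAdjoint S
  nonneg : ∀ x : S.domain, 0 ≤ RCLike.re (inner 𝕜 (S x) (x : H))
  mem_iff : ∀ x : H, x ∈ A.domain ↔ ∃ h : x ∈ S.domain, S ⟨x, h⟩ ∈ S.domain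
  sq : ∀ (x : H) (hA : x ∈ A.domain) (h : x ∈ S.domain) (h' : S ⟨x, h⟩ ∈ S.domain),
    S ⟨S ⟨x, h⟩, h'⟩ = A ⟨x, hA⟩

/-! ### Square roots of bounded positive operators -/

section Sqrt

open scoped ComplexOrder

/-- The Taylor coefficients of `1 - √(1 - x)`, shifted by one. -/
def sqrtCoeff (n : ℕ) : ℝ := 2 * (catalan n : ℝ) / 4 ^ (n + 1)

lemma sqrtCoeff_nonneg (n : ℕ) : 0 ≤ sqrtCoeff n := by unfold sqrtCoeff; positivity

lemma sqrtCoeff_zero : sqrtCoeff 0 = 1 / 2 := by norm_num [sqrtCoeff]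

lemma sqrtCoeff_succ (n : ℕ) : 2 * sqrtCoeff (n + 1) =
    ∑ ij ∈ Finset.HasAntidiagonal.antidiagonal n, sqrtCoeff ij.1 * sqrtCoeff ij.2 := by
  have h : ∀ ij ∈ Finset.HasAntidiagonal.antidiagonal n, sqrtCoeff ij.1 * sqrtCoeff ij.2 =
      (4 / 4 ^ (n + 2)) * ((catalan ij.1 : ℝ) * catalan ij.2) := by
    intro ij hij
    have : ij.1 + ij.2 = n := Finset.HasAntidiagonal.mem_antidiagonal.mp hij
    subst this
    unfold sqrtCoeff
    field_simp
    ring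
  rw [Finset.sum_congr rfl h, ← Finset.mul_sum]
  unfold sqrtCoeff
  rw [catalan_succ']
  push_cast
  ring

lemma sum_sqrtCoeff_le (N : ℕ) : ∑ n ∈ Finset.range N, sqrtCoeff n ≤ 1 := by
  induction N with
  | zero => simp
  | succ N ih =>
    rw [Finset.sum_range_succ', sqrtCoeff_zero]
    have h0 : 0 ≤ ∑ n ∈ Finset.range N, sqrtCoeff n :=
      Finset.sum_nonneg fun n _ => sqrtCoeff_nonneg n
    have h1 : 2 * ∑ n ∈ Finset.range N, sqrtCoeff (n + 1) ≤
        (∑ n ∈ Finset.range N, sqrtCoeff n) * ∑ n ∈ Finset.range N, sqrtCoeff n := by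
      rw [Finset.mul_sum, Finset.sum_congr rfl fun n _ => sqrtCoeff_succ n,
        Finset.sum_mul_sum, ← Finset.sum_product', Finset.sum_sigma']
      refine le_of_eq_of_le (Finset.sum_nbij (t := (((Finset.range N).sigma
          fun n => Finset.HasAntidiagonal.antidiagonal n).image Sigma.snd)) (g := fun ij => sqrtCoeff ij.1 * sqrtCoeff ij.2) Sigma.snd ?_ ?_ ?_ ?_)
        (Finset.sum_le_sum_of_subset_of_nonneg ?_ ?_)
      · intro a ha; exact Finset.mem_image_of_mem _ ha
      · rintro ⟨a, x⟩ ha ⟨b, y⟩ hb (h : x = y)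
        simp only [Finset.coe_sigma, Set.mem_sigma_iff, Finset.mem_coe,
          Finset.HasAntidiagonal.mem_antidiagonal] at ha hb
        subst h
        obtain rfl : a = b := by rw [← ha.2, ← hb.2]
        rfl
      · intro x hx; simpa using hx
      · intro a _; rfl
      · intro x hx
        simp only [Finset.mem_image, Finset.mem_sigma, Finset.mem_range,
          Finset.HasAntidiagonal.mem_antidiagonal, Finset.mem_product] at hx ⊢
        obtain ⟨⟨a, y⟩, ⟨h1, h2⟩, rfl⟩ := hx
        simp only at h1 h2 ⊢
        omega
      · intro x _ _; exact mul_nonneg (sqrtCoeff_nonneg _) (sqrtCoeff_nonneg _)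
    nlinarith

lemma summable_sqrtCoeff : Summable sqrtCoeff :=
  summable_of_sum_range_le sqrtCoeff_nonneg sum_sqrtCoeff_le

/-- A bounded operator `0 ≤ T ≤ 1` has a nonnegative self-adjoint square root. -/
lemma exists_sqrt_of_le_one (T : H →L[𝕜] H) (hT : T.IsPositive) (hT1 : ‖1 - T‖ ≤ 1) :
    ∃ S : H →L[𝕜] H, S.IsPositive ∧ S * S = T := by
  set X : H →L[𝕜] H := 1 - T with hX
  have hXsa : IsSelfAdjoint X := (IsSelfAdjoint.one _).sub hT.isSelfAdjoint
  let f : ℕ → (H →L[𝕜] H) := fun n => (sqrtCoeff n : 𝕜) • X ^ (n + 1)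
  have hfn : ∀ n, ‖f n‖ ≤ sqrtCoeff n := fun n => by
    have h1 : ‖X ^ (n + 1)‖ ≤ 1 :=
      (norm_pow_le' X n.succ_pos).trans (pow_le_one₀ (norm_nonneg _) hT1)
    calc ‖f n‖ = sqrtCoeff n * ‖X ^ (n + 1)‖ := by
          simp only [f]
          rw [norm_smul, RCLike.norm_ofReal, abs_of_nonneg (sqrtCoeff_nonneg n)]
      _ ≤ sqrtCoeff n * 1 := mul_le_mul_of_nonneg_left h1 (sqrtCoeff_nonneg n)
      _ = _ := mul_one _
  have hfs : Summable fun n => ‖f n‖ :=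
    Summable.of_nonneg_of_le (fun _ => norm_nonneg _) hfn summable_sqrtCoeff
  have hfs' : Summable f := hfs.of_norm
  set s := ∑' n, f n with hs
  have hsn : ‖s‖ ≤ 1 := by
    refine (norm_tsum_le_tsum_norm hfs).trans ((hfs.tsum_le_tsum hfn summable_sqrtCoeff).trans ?_)
    exact summable_sqrtCoeff.tsum_le_of_sum_range_le sum_sqrtCoeff_le
  have hssa : IsSelfAdjoint s := by
    rw [IsSelfAdjoint, hs, tsum_star]
    refine tsum_congr fun n => ?_
    simp only [f, star_smul, star_pow, hXsa.star_eq]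
    congr 1
    simp
  have hss : s * s = (2 : 𝕜) • s - X := by
    have e1 : s * s = ∑' n, (2 : 𝕜) • f (n + 1) := by
      rw [hs, tsum_mul_tsum_eq_tsum_sum_antidiagonal_of_summable_norm hfs hfs]
      refine tsum_congr fun n => ?_
      have : ∀ ij ∈ Finset.HasAntidiagonal.antidiagonal n, f ij.1 * f ij.2 =
          (((sqrtCoeff ij.1 * sqrtCoeff ij.2 : ℝ)) : 𝕜) • X ^ (n + 2) := by
        intro ij hij
        have : ij.1 + ij.2 = n := Finset.HasAntidiagonal.mem_antidiagonal.mp hij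
        subst this
        simp only [f, smul_mul_smul_comm, ← pow_add]
        push_cast
        congr 2
        ring
      rw [Finset.sum_congr rfl this, ← Finset.sum_smul]
      simp only [f]
      rw [smul_smul]
      congr 1
      rw [← RCLike.ofReal_sum, ← sqrtCoeff_succ]
      push_cast
      ring
    have e2 : s = f 0 + ∑' n, f (n + 1) := hfs'.tsum_eq_zero_add
    have e3 : (2 : 𝕜) • f 0 = X := by
      simp only [f, sqrtCoeff_zero, zero_add, pow_one, smul_smul]
      rw [← RCLike.ofReal_ofNat (K := 𝕜) 2, ← RCLike.ofReal_mul]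
      norm_num
    rw [e1, ((summable_nat_add_iff 1).mpr hfs').tsum_const_smul, e2, smul_add, e3]
    abel
  refine ⟨1 - s, ?_, ?_⟩
  · rw [ContinuousLinearMap.isPositive_def']
    refine ⟨(IsSelfAdjoint.one _).sub hssa, fun x => ?_⟩
    have h1 : RCLike.re (inner 𝕜 (s x) x) ≤ ‖x‖ * ‖x‖ := by
      refine (RCLike.re_le_norm _).trans ((norm_inner_le_norm _ _).trans ?_)
      refine mul_le_mul_of_nonneg_right ?_ (norm_nonneg _)
      exact (s.le_opNorm x).trans (mul_le_of_le_one_left (norm_nonneg _) hsn)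
    rw [ContinuousLinearMap.reApplyInnerSelf_apply]
    simp only [sub_apply, one_apply_eq_self, inner_sub_left,
      map_sub]
    rw [inner_self_eq_norm_mul_norm]
    linarith
  · have : (1 - s) * (1 - s) = 1 - (2 : 𝕜) • s + s * s := by
      rw [two_smul]; noncomm_ring
    rw [this, hss, hX]
    abel

lemma exists_sqrt_bounded (T : H →L[𝕜] H) (hT : T.IsPositive) :
    ∃ S : H →L[𝕜] H, S.IsPositive ∧ S * S = T := by
  have hc : 0 < ‖T‖ + 1 := by positivity
  set c : ℝ := ‖T‖ + 1 with hcdef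
  have hnn : ∀ r : ℝ, 0 ≤ r → (0 : 𝕜) ≤ (r : 𝕜) := fun r hr => RCLike.ofReal_nonneg.mpr hr
  set T' : H →L[𝕜] H := ((c⁻¹ : ℝ) : 𝕜) • T with hT'
  have hpos : T'.IsPositive := hT.smul_of_nonneg (hnn _ (inv_nonneg.mpr hc.le))
  have hT'n : ‖T'‖ ≤ 1 := by
    rw [hT', norm_smul, RCLike.norm_ofReal, abs_of_pos (inv_pos.mpr hc), inv_mul_le_iff₀ hc]
    simp [hcdef]
  have h1 : ‖1 - T'‖ ≤ 1 := by
    have hsa : IsSelfAdjoint (1 - T') := (IsSelfAdjoint.one _).sub hpos.isSelfAdjoint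
    rw [ContinuousLinearMap.norm_eq_iSup_rayleighQuotient _ hsa.isSymmetric]
    refine ciSup_le fun x => ?_
    have e : (1 - T').reApplyInnerSelf x = ‖x‖ ^ 2 - RCLike.re (inner 𝕜 (T' x) x) := by
      rw [ContinuousLinearMap.reApplyInnerSelf_apply]
      simp only [sub_apply, one_apply_eq_self, inner_sub_left, map_sub, inner_self_eq_norm_sq]
    have h2 : RCLike.re (inner 𝕜 (T' x) x) ≤ ‖x‖ ^ 2 := by
      refine (RCLike.re_le_norm _).trans ((norm_inner_le_norm _ _).trans ?_)
      rw [sq]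
      refine mul_le_mul_of_nonneg_right ?_ (norm_nonneg _)
      exact (T'.le_opNorm x).trans (mul_le_of_le_one_left (norm_nonneg _) hT'n)
    have h3 := hpos.re_inner_nonneg_left x
    rw [ContinuousLinearMap.rayleighQuotient, e, abs_div, abs_of_nonneg (by linarith),
      abs_of_nonneg (by positivity)]
    exact div_le_one_of_le₀ (by linarith) (by positivity)
  obtain ⟨S, hS, hSS⟩ := exists_sqrt_of_le_one T' hpos h1
  refine ⟨((√c : ℝ) : 𝕜) • S, hS.smul_of_nonneg (hnn _ (Real.sqrt_nonneg c)), ?_⟩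
  rw [smul_mul_smul_comm, hSS, hT', smul_smul]
  rw [← RCLike.ofReal_mul, Real.mul_self_sqrt hc.le, ← RCLike.ofReal_mul,
    mul_inv_cancel₀ hc.ne', RCLike.ofReal_one, one_smul]

end Sqrt

/-! ### Resolvent and square root of a positive self-adjoint operator -/

namespace PosOp

variable (A : PosOp 𝕜 H)

/-- `μ + A` on the domain of `A`. -/
def shift (μ : ℝ) : A.op.domain →ₗ[𝕜] H := (μ : 𝕜) • A.op.domain.subtype + A.op.toFun

lemma shift_apply (μ : ℝ) (x : A.op.domain) : A.shift μ x = (μ : 𝕜) • (x : H) + A.op x := rfl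

lemma exists_bound : ∃ k : ℝ, 0 < k ∧ ∀ μ : ℝ, 0 ≤ μ → ∀ x : A.op.domain,
    ‖(x : H)‖ ≤ k * ‖A.shift μ x‖ := by
  obtain ⟨m, hm, h⟩ := A.bddBelow
  refine ⟨m⁻¹, inv_pos.mpr hm, fun μ hμ x => ?_⟩
  have h1 : m * ‖(x : H)‖ ^ 2 ≤ RCLike.re (inner 𝕜 (A.shift μ x) (x : H)) := by
    rw [shift_apply, inner_add_left, inner_smul_left, map_add, RCLike.conj_ofReal,
      RCLike.re_ofReal_mul, inner_self_eq_norm_sq]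
    nlinarith [h x, mul_nonneg hμ (sq_nonneg ‖(x : H)‖)]
  have h2 : RCLike.re (inner 𝕜 (A.shift μ x) (x : H)) ≤ ‖A.shift μ x‖ * ‖(x : H)‖ :=
    (RCLike.re_le_norm _).trans (norm_inner_le_norm _ _)
  rw [← div_eq_inv_mul, le_div_iff₀ hm]
  by_cases hx : ‖(x : H)‖ = 0
  · rw [hx]; simp
  · have hx' : 0 < ‖(x : H)‖ := lt_of_le_of_ne (norm_nonneg _) (Ne.symm hx)
    refine le_of_mul_le_mul_right ?_ hx'
    nlinarith

lemma shift_injective {μ : ℝ} (hμ : 0 ≤ μ) : Function.Injective (A.shift μ) := by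
  obtain ⟨k, hk, h⟩ := A.exists_bound
  rw [injective_iff_map_eq_zero]
  intro x hx
  have := h μ hμ x
  rw [hx, norm_zero, mul_zero] at this
  ext
  simpa using this

lemma shift_surjective {μ : ℝ} (hμ : 0 ≤ μ) : Function.Surjective (A.shift μ) := by
  obtain ⟨k, hk, h⟩ := A.exists_bound
  have hcl : IsClosed ((LinearMap.range (A.shift μ) : Submodule 𝕜 H) : Set H) := by
    refine isSeqClosed_iff_isClosed.mp fun u f hu huf => ?_
    choose x hx using hu
    have hxc : CauchySeq fun n => ((x n : A.op.domain) : H) := by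
      rw [Metric.cauchySeq_iff']
      intro ε hε
      obtain ⟨N, hN⟩ := Metric.cauchySeq_iff'.mp huf.cauchySeq (ε / k) (div_pos hε hk)
      refine ⟨N, fun n hn => ?_⟩
      have h1 := h μ hμ (x n - x N)
      rw [map_sub, hx, hx, ← dist_eq_norm] at h1
      have h2 := hN n hn
      rw [lt_div_iff₀ hk] at h2
      rw [dist_eq_norm]
      have : ((x n - x N : A.op.domain) : H) = (x n : H) - x N := rfl
      rw [this] at h1
      linarith
    obtain ⟨y, hy⟩ := cauchySeq_tendsto_of_complete hxc
    have hAy : Filter.Tendsto (fun n => A.op (x n)) Filter.atTop (nhds (f - (μ : 𝕜) • y)) := by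
      have : (fun n => A.op (x n)) = fun n => u n - (μ : 𝕜) • (x n : H) := by
        funext n
        rw [← hx n, shift_apply]
        abel
      rw [this]
      exact huf.sub (hy.const_smul _)
    obtain ⟨hyd, hye⟩ := selfAdj_mem A.selfAdj y (f - (μ : 𝕜) • y) fun z => by
      have t1 : Filter.Tendsto (fun n => inner 𝕜 (A.op (x n)) (z : H)) Filter.atTop
          (nhds (inner 𝕜 (f - (μ : 𝕜) • y) (z : H))) := hAy.inner tendsto_const_nhds
      have t2 : Filter.Tendsto (fun n => inner 𝕜 (x n : H) (A.op z)) Filter.atTop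
          (nhds (inner 𝕜 y (A.op z))) := hy.inner tendsto_const_nhds
      refine tendsto_nhds_unique t1 (t2.congr fun n => ?_)
      exact (selfAdj_symm A.selfAdj (x n) z).symm
    refine ⟨⟨y, hyd⟩, ?_⟩
    rw [shift_apply, hye]
    simp
  have hperp : (LinearMap.range (A.shift μ) : Submodule 𝕜 H)ᗮ = ⊥ := by
    rw [Submodule.eq_bot_iff]
    intro y hy
    obtain ⟨hyd, hye⟩ := selfAdj_mem A.selfAdj y (-((μ : 𝕜) • y)) fun z => by
      have h0 := (Submodule.mem_orthogonal' _ _).mp hy (A.shift μ z) ⟨z, rfl⟩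
      rw [shift_apply, inner_add_right, inner_smul_right] at h0
      rw [inner_neg_left, inner_smul_left, RCLike.conj_ofReal]
      exact neg_eq_of_add_eq_zero_right h0
    have : A.shift μ ⟨y, hyd⟩ = 0 := by rw [shift_apply, hye]; simp
    have := A.shift_injective hμ (this.trans (map_zero _).symm)
    exact congrArg Subtype.val this
  have htop : (LinearMap.range (A.shift μ) : Submodule 𝕜 H) = ⊤ := by
    rw [← hcl.submodule_topologicalClosure_eq, Submodule.topologicalClosure_eq_top_iff]
    exact hperp
  exact LinearMap.range_eq_top.mp htop

lemma op_surjective (f : H) : ∃ x : A.op.domain, A.op x = f := by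
  obtain ⟨x, hx⟩ := A.shift_surjective le_rfl f
  refine ⟨x, ?_⟩
  rw [← hx, shift_apply]
  simp

/-- The bijection `μ + A` from the domain of `A` onto the whole space, for `μ ≥ 0`. -/
def shiftEquiv {μ : ℝ} (hμ : 0 ≤ μ) : A.op.domain ≃ₗ[𝕜] H :=
  LinearEquiv.ofBijective (A.shift μ) ⟨A.shift_injective hμ, A.shift_surjective hμ⟩

lemma shift_shiftEquiv_symm {μ : ℝ} (hμ : 0 ≤ μ) (f : H) :
    A.shift μ ((A.shiftEquiv hμ).symm f) = f :=
  (A.shiftEquiv hμ).apply_symm_apply f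

/-- The bounded inverse `A⁻¹`. -/
def inv : H →L[𝕜] H :=
  (A.op.domain.subtype ∘ₗ (A.shiftEquiv le_rfl).symm.toLinearMap).mkContinuousOfExistsBound <| by
    obtain ⟨k, -, h⟩ := A.exists_bound
    refine ⟨k, fun f => ?_⟩
    have := h 0 le_rfl ((A.shiftEquiv le_rfl).symm f)
    rwa [shift_shiftEquiv_symm] at this

lemma inv_mem (f : H) : A.inv f ∈ A.op.domain := ((A.shiftEquiv le_rfl).symm f).2

lemma op_inv (f : H) : A.op ⟨A.inv f, A.inv_mem f⟩ = f := by
  have := A.shift_shiftEquiv_symm le_rfl f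
  rw [shift_apply, RCLike.ofReal_zero, zero_smul, zero_add] at this
  exact this

lemma inv_op (x : A.op.domain) : A.inv (A.op x) = x := by
  have h1 : A.shift 0 ⟨A.inv (A.op x), A.inv_mem _⟩ = A.shift 0 x := by
    simp only [shift_apply, RCLike.ofReal_zero, zero_smul, zero_add, op_inv]
  exact congrArg Subtype.val (A.shift_injective le_rfl h1)

lemma inv_isPositive : A.inv.IsPositive := by
  refine ⟨fun f g => ?_, fun f => ?_⟩
  · have := selfAdj_symm A.selfAdj ⟨A.inv f, A.inv_mem f⟩ ⟨A.inv g, A.inv_mem g⟩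
    rw [op_inv, op_inv] at this
    exact this.symm
  · obtain ⟨m, hm, h⟩ := A.bddBelow
    have := h ⟨A.inv f, A.inv_mem f⟩
    rw [op_inv] at this
    change 0 ≤ RCLike.re (inner 𝕜 (A.inv f) f)
    rw [← inner_conj_symm, RCLike.conj_re]
    exact le_trans (by positivity) this

/-- Every positive self-adjoint operator has a positive square root. -/
lemma exists_sqrt : ∃ S : H →ₗ.[𝕜] H, IsPosSqrt S A.op := by
  obtain ⟨R, hR, hRR⟩ := exists_sqrt_bounded A.inv A.inv_isPositive
  have hRR' : ∀ f, R (R f) = A.inv f := fun f => by rw [← hRR]; rfl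
  have hinj : Function.Injective R.toLinearMap := by
    rw [injective_iff_map_eq_zero]
    intro f hf
    have h1 : A.inv f = 0 := by
      rw [← hRR']
      have : R f = 0 := hf
      rw [this, map_zero]
    have h2 := A.op_inv f
    have h3 : (⟨A.inv f, A.inv_mem f⟩ : A.op.domain) = 0 := Subtype.ext h1
    rw [h3, LinearPMap.map_zero] at h2
    exact h2.symm
  let S : H →ₗ.[𝕜] H :=
    ⟨LinearMap.range R.toLinearMap, (LinearEquiv.ofInjective R.toLinearMap hinj).symm.toLinearMap⟩
  have hRS : ∀ x : S.domain, R (S x) = x := fun x =>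
    congrArg Subtype.val ((LinearEquiv.ofInjective R.toLinearMap hinj).apply_symm_apply x)
  have hSR : ∀ (x : H) (h : R x ∈ S.domain), S ⟨R x, h⟩ = x := fun x h =>
    hinj (hRS ⟨R x, h⟩)
  have hmem : ∀ x, R x ∈ S.domain := fun x => ⟨x, rfl⟩
  refine ⟨S, ?_, ?_, ?_, ?_⟩
  · refine isSelfAdjoint_of_symm_surj (fun x y => ?_) fun f => ⟨⟨R f, hmem f⟩, hSR f _⟩
    conv_lhs => rw [← hRS y]
    conv_rhs => rw [← hRS x]
    exact (hR.isSymmetric (S x) (S y)).symm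
  · intro x
    conv_rhs => rw [← hRS x]
    exact hR.re_inner_nonneg_right _
  · intro x
    constructor
    · intro hx
      have h1 : R (R (A.op ⟨x, hx⟩)) = x := by rw [hRR', A.inv_op]
      have h2 : x ∈ S.domain := by rw [← h1]; exact hmem _
      refine ⟨h2, ?_⟩
      have h3 : S ⟨x, h2⟩ = R (A.op ⟨x, hx⟩) := hinj ((hRS _).trans h1.symm)
      rw [h3]
      exact hmem _
    · rintro ⟨h, f, hf⟩
      have hf' : R f = S ⟨x, h⟩ := hf
      have : x = A.inv f := by rw [← hRR', hf', hRS]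
      rw [this]
      exact A.inv_mem f
  · intro x hA h h'
    apply hinj
    apply hinj
    have e1 : R (S ⟨S ⟨x, h⟩, h'⟩) = S ⟨x, h⟩ := hRS _
    change R (R (S ⟨S ⟨x, h⟩, h'⟩)) = R (R (A.op ⟨x, hA⟩))
    rw [e1, hRS, hRR', A.inv_op]

/-- The positive square root `A^{1/2}`. -/
def sqrt : H →ₗ.[𝕜] H := Classical.choose A.exists_sqrt

lemma sqrt_spec : IsPosSqrt A.sqrt A.op := Classical.choose_spec A.exists_sqrt

lemma domain_le : A.op.domain ≤ A.sqrt.domain := fun x hx => ((A.sqrt_spec.mem_iff x).mp hx).1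

lemma sqrt_mem {x : H} (hx : x ∈ A.op.domain) :
    A.sqrt ⟨x, A.domain_le hx⟩ ∈ A.sqrt.domain := ((A.sqrt_spec.mem_iff x).mp hx).2

lemma sqrt_sqrt {x : H} (hx : x ∈ A.op.domain) :
    A.sqrt ⟨A.sqrt ⟨x, A.domain_le hx⟩, A.sqrt_mem hx⟩ = A.op ⟨x, hx⟩ :=
  A.sqrt_spec.sq x hx _ _

/-- `⟨A x, y⟩ = ⟨A^{1/2} x, A^{1/2} y⟩` for `x` in the domain of `A`. -/
lemma inner_op (x : A.op.domain) (y : A.sqrt.domain) :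
    inner 𝕜 (A.op x) (y : H) = inner 𝕜 (A.sqrt ⟨x, A.domain_le x.2⟩) (A.sqrt y) := by
  rw [← selfAdj_symm A.sqrt_spec.selfAdj ⟨_, A.sqrt_mem x.2⟩ y, A.sqrt_sqrt x.2]

lemma sqrt_surjective (f : H) : ∃ x : A.sqrt.domain, A.sqrt x = f := by
  obtain ⟨x, rfl⟩ := A.op_surjective f
  exact ⟨⟨_, A.sqrt_mem x.2⟩, A.sqrt_sqrt x.2⟩

lemma sqrt_bound : ∃ k : ℝ, 0 < k ∧ ∀ x : A.sqrt.domain, ‖(x : H)‖ ≤ k * ‖A.sqrt x‖ := by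
  obtain ⟨k, hk, h⟩ := A.exists_bound
  refine ⟨√k, Real.sqrt_pos.mpr hk, fun x => ?_⟩
  obtain ⟨z, hz⟩ := A.op_surjective (x : H)
  set w := A.sqrt ⟨z, A.domain_le z.2⟩ with hw
  have h1 : ‖(x : H)‖ ^ 2 ≤ ‖w‖ * ‖A.sqrt x‖ := by
    have := A.inner_op z x
    rw [hz] at this
    have h2 : ‖(x : H)‖ ^ 2 = ‖(inner 𝕜 (x : H) (x : H) : 𝕜)‖ := by
      rw [inner_self_eq_norm_sq_to_K, norm_pow, RCLike.norm_ofReal, abs_norm]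
    rw [h2, this]
    exact norm_inner_le_norm _ _
  have h2 : ‖w‖ ^ 2 ≤ ‖(x : H)‖ * ‖(z : H)‖ := by
    have := A.inner_op z ⟨z, A.domain_le z.2⟩
    rw [hz] at this
    have h2 : ‖w‖ ^ 2 = ‖(inner 𝕜 w w : 𝕜)‖ := by
      rw [inner_self_eq_norm_sq_to_K, norm_pow, RCLike.norm_ofReal, abs_norm]
    rw [h2, hw, ← this]
    exact norm_inner_le_norm _ _
  have h3 : ‖(z : H)‖ ≤ k * ‖(x : H)‖ := by
    have := h 0 le_rfl z
    rwa [shift_apply, RCLike.ofReal_zero, zero_smul, zero_add, hz] at this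
  have h4 : ‖w‖ ≤ √k * ‖(x : H)‖ := by
    refine abs_le_of_sq_le_sq' ?_ (by positivity) |>.2
    rw [mul_pow, Real.sq_sqrt hk.le]
    nlinarith [norm_nonneg (x : H)]
  by_cases hx : ‖(x : H)‖ = 0
  · rw [hx]; positivity
  · have hx' : 0 < ‖(x : H)‖ := lt_of_le_of_ne (norm_nonneg _) (Ne.symm hx)
    refine le_of_mul_le_mul_right ?_ hx'
    nlinarith [norm_nonneg (A.sqrt x), mul_le_mul_of_nonneg_right h4 (norm_nonneg (A.sqrt x))]

lemma sqrt_injective : Function.Injective A.sqrt.toFun := by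
  obtain ⟨k, -, h⟩ := A.sqrt_bound
  rw [injective_iff_map_eq_zero]
  intro x hx
  have h1 := h x
  have hx' : A.sqrt x = 0 := hx
  rw [hx', norm_zero, mul_zero] at h1
  ext
  simpa using h1

/-! ### The Hilbert spaces `H_{1/2}` and `H_{-1/2}` -/

/-- The energy space `H_{1/2} = D(A^{1/2})`, with inner product `⟨A^{1/2} x, A^{1/2} y⟩` and
norm `‖A^{1/2} x‖`. -/
def Half : Type _ := A.sqrt.domain

namespace Half

instance : AddCommGroup A.Half := inferInstanceAs (AddCommGroup A.sqrt.domain)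

instance : Module 𝕜 A.Half := inferInstanceAs (Module 𝕜 A.sqrt.domain)

end Half

/-- The operator `A^{1/2}` as a linear map on `H_{1/2}`. -/
def halfMap : A.Half →ₗ[𝕜] H := A.sqrt.toFun

/-- The inclusion of `H_{1/2}` in `H`, as a linear map. -/
def halfIncl : A.Half →ₗ[𝕜] H := A.sqrt.domain.subtype

namespace Half

instance : NormedAddCommGroup A.Half := NormedAddCommGroup.induced A.Half H A.halfMap A.sqrt_injective

lemma norm_def (x : A.Half) : ‖x‖ = ‖A.halfMap x‖ := rfl

instance : NormedSpace 𝕜 A.Half := NormedSpace.induced 𝕜 A.Half H A.halfMap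

instance : InnerProductSpace 𝕜 A.Half where
  inner x y := inner 𝕜 (A.halfMap x) (A.halfMap y)
  norm_sq_eq_re_inner x := by rw [norm_def]; exact norm_sq_eq_re_inner _
  conj_inner_symm x y := inner_conj_symm _ _
  add_left x y z := by simp only [map_add, inner_add_left]
  smul_left x y r := by simp only [map_smul, inner_smul_left]

lemma inner_def (x y : A.Half) :
    (inner 𝕜 x y : 𝕜) = inner 𝕜 (A.halfMap x) (A.halfMap y) := rfl

instance : CompleteSpace A.Half := by
  let e : A.Half ≃ₗᵢ[𝕜] H :=
    ⟨LinearEquiv.ofBijective A.halfMap ⟨A.sqrt_injective, A.sqrt_surjective⟩, fun _ => rfl⟩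
  exact (completeSpace_congr (e := e.toEquiv) e.isometry.isUniformEmbedding).mpr inferInstance

end Half

/-- The continuous inclusion of `H_{1/2}` in `H`. -/
def incl : A.Half →L[𝕜] H := A.halfIncl.mkContinuousOfExistsBound <| by
  obtain ⟨k, -, h⟩ := A.sqrt_bound
  exact ⟨k, h⟩

/-- The dual space `H_{-1/2} = (H_{1/2})*` of continuous conjugate-linear functionals, so that
`y ζ` is the pairing `⟨y, ζ⟩`, linear in `y`. -/
abbrev NegHalf : Type _ := A.Half →L⋆[𝕜] 𝕜

/-- The continuous embedding of `H` in `H_{-1/2}`: `f` acts by `ζ ↦ ⟨f, ζ⟩`, the inner product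
of `H` being linear in `f`. -/
def embed : H →L[𝕜] A.NegHalf :=
  ((innerSLFlip 𝕜 : H →L[𝕜] H →L⋆[𝕜] 𝕜).flip.comp A.incl).flip

lemma embed_apply (f : H) (ζ : A.Half) : A.embed f ζ = inner 𝕜 (A.incl ζ) f := rfl

/-- The bounded extension `A : H_{1/2} → H_{-1/2}`, `⟨A x, ζ⟩ = ⟨A^{1/2} x, A^{1/2} ζ⟩`. -/
def energyOp : A.Half →L[𝕜] A.NegHalf := innerSLFlip 𝕜

lemma energyOp_apply (x ζ : A.Half) :
    A.energyOp x ζ = inner 𝕜 (A.halfMap ζ) (A.halfMap x) := rfl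

/-- The element of `H_{1/2}` given by an element of `D(A)`. -/
def ofDomain : A.op.domain →ₗ[𝕜] A.Half := Submodule.inclusion A.domain_le

/-- The extension of `A` to `H_{1/2}` agrees with `A` on `D(A)`. -/
lemma energyOp_ofDomain (x : A.op.domain) : A.energyOp (A.ofDomain x) = A.embed (A.op x) := by
  ext ζ
  rw [energyOp_apply, embed_apply, ← inner_conj_symm, ← inner_conj_symm (A.incl ζ)]
  exact congrArg _ (A.inner_op x ζ).symm

lemma re_inner_op (x : A.op.domain) :
    RCLike.re (inner 𝕜 (A.op x) (x : H)) = ‖A.ofDomain x‖ ^ 2 := by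
  have := A.inner_op x ⟨x, A.domain_le x.2⟩
  rw [this, inner_self_eq_norm_sq]
  rfl

/-- The resolvent `(μ + A)⁻¹` for `μ ≥ 0`, as a bounded operator from `H` to `H_{1/2}`. -/
def resolvent {μ : ℝ} (hμ : 0 ≤ μ) : H →L[𝕜] A.Half :=
  (A.ofDomain ∘ₗ (A.shiftEquiv hμ).symm.toLinearMap).mkContinuousOfExistsBound <| by
    obtain ⟨k, hk, h⟩ := A.sqrt_bound
    refine ⟨k, fun f => ?_⟩
    set x := (A.shiftEquiv hμ).symm f with hx
    have h0 : A.shift μ x = f := A.shift_shiftEquiv_symm hμ f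
    change ‖A.ofDomain x‖ ≤ k * ‖f‖
    have h1 : ‖(x : H)‖ ≤ k * ‖A.ofDomain x‖ := h (A.ofDomain x)
    have h2 : ‖A.ofDomain x‖ ^ 2 ≤ ‖f‖ * ‖(x : H)‖ := by
      rw [← re_inner_op]
      refine le_trans ?_ ((RCLike.re_le_norm _).trans (norm_inner_le_norm (𝕜 := 𝕜) f (x : H)))
      rw [← h0, shift_apply, inner_add_left, inner_smul_left, map_add, RCLike.conj_ofReal,
        RCLike.re_ofReal_mul, inner_self_eq_norm_sq]
      nlinarith [mul_nonneg hμ (sq_nonneg ‖(x : H)‖)]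
    by_cases hz : ‖A.ofDomain x‖ = 0
    · rw [hz]; positivity
    · have hz' : 0 < ‖A.ofDomain x‖ := lt_of_le_of_ne (norm_nonneg _) (Ne.symm hz)
      refine le_of_mul_le_mul_right ?_ hz'
      nlinarith [norm_nonneg f, mul_le_mul_of_nonneg_left h1 (norm_nonneg f)]

/-- `resolvent` takes values in `D(A)` and inverts `μ + A`. -/
lemma resolvent_spec {μ : ℝ} (hμ : 0 ≤ μ) (f : H) :
    ∃ x : A.op.domain, A.resolvent hμ f = A.ofDomain x ∧ (μ : 𝕜) • (x : H) + A.op x = f :=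
  ⟨(A.shiftEquiv hμ).symm f, rfl, A.shift_shiftEquiv_symm hμ f⟩

end PosOp

/-! ### Control operators, couplings and transfer functions -/

section Control

variable {U : Type*} [NormedAddCommGroup U] [InnerProductSpace 𝕜 U] [CompleteSpace U]

/-- The adjoint `B* : H_{1/2} → U` of a control operator `B : U → H_{-1/2}`, where `U` is
identified with its dual. -/
def adjControl {A : PosOp 𝕜 H} (B : U →L[𝕜] A.NegHalf) : A.Half →L[𝕜] U :=
  ((InnerProductSpace.toDual 𝕜 U).symm.toContinuousLinearEquiv :
    StrongDual 𝕜 U →L⋆[𝕜] U).comp B.flip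

lemma inner_adjControl {A : PosOp 𝕜 H} (B : U →L[𝕜] A.NegHalf) (z : A.Half) (u : U) :
    inner 𝕜 (adjControl B z) u = B u z := by
  simp [adjControl]

/-- The continuous embedding `H_{1/2} ↪ D(T)`, where `D(T)` carries the graph norm. -/
def ContEmbeds (A : PosOp 𝕜 H) (T : H →ₗ.[𝕜] K) : Prop :=
  ∃ c : ℝ, ∀ x : A.Half, ∃ h : A.incl x ∈ T.domain,
    ‖A.incl x‖ + ‖T ⟨A.incl x, h⟩‖ ≤ c * ‖x‖

/-- The restriction of `T` to `H_{1/2}`, a bounded operator from `H_{1/2}`. -/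
def ContEmbeds.restrict {A : PosOp 𝕜 H} {T : H →ₗ.[𝕜] K} (hT : ContEmbeds A T) :
    A.Half →L[𝕜] K :=
  (T.toFun ∘ₗ (A.incl.toLinearMap.codRestrict T.domain fun x =>
    (Classical.choose_spec hT x).1)).mkContinuousOfExistsBound <| by
    obtain ⟨c, hc⟩ := hT
    refine ⟨c, fun x => ?_⟩
    obtain ⟨h, hx⟩ := hc x
    exact le_trans (le_add_of_nonneg_left (norm_nonneg _)) hx

lemma ContEmbeds.mem {A : PosOp 𝕜 H} {T : H →ₗ.[𝕜] K} (hT : ContEmbeds A T) (x : A.Half) :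
    A.incl x ∈ T.domain := (Classical.choose_spec hT x).1

lemma ContEmbeds.restrict_apply {A : PosOp 𝕜 H} {T : H →ₗ.[𝕜] K} (hT : ContEmbeds A T)
    (x : A.Half) : hT.restrict x = T ⟨A.incl x, hT.mem x⟩ := rfl

/-- The operator `s - 𝓐 : V → W`, where `gen : V → W` is the bounded extension of a generator `𝓐`
and `J : V → W` is the canonical embedding. -/
def shifted {V W : Type*} [NormedAddCommGroup V] [NormedSpace 𝕜 V]
    [NormedAddCommGroup W] [NormedSpace 𝕜 W] (J gen : V →L[𝕜] W) (s : 𝕜) : V →L[𝕜] W :=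
  s • J - gen

lemma shifted_apply {V W : Type*} [NormedAddCommGroup V] [NormedSpace 𝕜 V]
    [NormedAddCommGroup W] [NormedSpace 𝕜 W] (J gen : V →L[𝕜] W) (s : 𝕜) (x : V) :
    shifted J gen s x = s • J x - gen x := rfl

/-- The transfer function `s ↦ 𝓑* (s - 𝓐)⁻¹ 𝓑` of a linear system `Ẋ = 𝓐 X + 𝓑 u`, `y = 𝓑* X`.
Since `𝓑 u` lies outside of the state space, the equation `s X - 𝓐 X = 𝓑 u` is
read in the larger space `W`, with `s - 𝓐 : V → W` as in `shifted`. -/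
def transferFunction {V W : Type*} [NormedAddCommGroup V] [NormedSpace 𝕜 V]
    [NormedAddCommGroup W] [NormedSpace 𝕜 W] (J gen : V →L[𝕜] W) (control : U →L[𝕜] W)
    (observe : V →L[𝕜] U) (s : 𝕜) : U →L[𝕜] U :=
  observe ∘L (shifted J gen s).inverse ∘L control

end Control

/-! ### Second order systems `Ẅ + A W + 𝓑₀ 𝓑₀* Ẇ = 0` -/

namespace SecondOrder

variable {U : Type*} [NormedAddCommGroup U] [InnerProductSpace 𝕜 U] [CompleteSpace U]
variable (A : PosOp 𝕜 H)

/-- The embedding `H_{1/2} × H_{1/2} → H_{1/2} × H_{-1/2}`, extending that of the domain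
`D(A) × D(A^{1/2})` of the generator in the state space `D(A^{1/2}) × H`. -/
def J : (A.Half × A.Half) →L[𝕜] (A.Half × A.NegHalf) :=
  (ContinuousLinearMap.id 𝕜 A.Half).prodMap (A.embed ∘L A.incl)

/-- The generator `(x, y) ↦ (y, -A x)`, extended to `H_{1/2} × H_{1/2}`. -/
def gen : (A.Half × A.Half) →L[𝕜] (A.Half × A.NegHalf) :=
  (ContinuousLinearMap.snd 𝕜 A.Half A.Half).prod
    (-(A.energyOp ∘L ContinuousLinearMap.fst 𝕜 A.Half A.Half))

/-- On `D(A) × D(A^{1/2})` the extended generator is the generator `(x, y) ↦ (y, -A x)`. -/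
lemma gen_ofDomain (x : A.op.domain) (y : A.Half) :
    gen A (A.ofDomain x, y) = (y, A.embed (-A.op x)) := by
  rw [map_neg, ← A.energyOp_ofDomain x]
  rfl

variable {A}

/-- The control operator `u ↦ (0, 𝓑₀ u)` of the open loop system `Ẅ + A W = 𝓑₀ u`. -/
def control (B₀ : U →L[𝕜] A.NegHalf) : U →L[𝕜] (A.Half × A.NegHalf) :=
  ContinuousLinearMap.inr 𝕜 A.Half A.NegHalf ∘L B₀

/-- The observation `(W, Ẇ) ↦ 𝓑₀* Ẇ`. -/
def observe (B₀ : U →L[𝕜] A.NegHalf) : (A.Half × A.Half) →L[𝕜] U :=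
  adjControl B₀ ∘L ContinuousLinearMap.snd 𝕜 A.Half A.Half

/-- The transfer function of `Ẅ + A W + 𝓑₀ 𝓑₀* Ẇ = 0`, that is, of the open loop system
`Ẅ + A W = 𝓑₀ u`, `y = 𝓑₀* Ẇ`. -/
def transfer (B₀ : U →L[𝕜] A.NegHalf) (s : 𝕜) : U →L[𝕜] U :=
  transferFunction (J A) (gen A) (control B₀) (observe B₀) s

end SecondOrder

/-! ### The coupled system -/

/-- The data of the coupled system: positive self-adjoint operators `A₁`, `A₂`, a bounded control
operator `B : U → H_{1,-1/2}` and an unbounded coupling operator `C : H₂ ⊇ D(C) → H₁` with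
`H_{2,1/2} ↪ D(C)` and `H_{1,1/2} ↪ D(C*)`. -/
structure CoupledData (𝕜 : Type*) [RCLike 𝕜] (H₁ H₂ U : Type*)
    [NormedAddCommGroup H₁] [InnerProductSpace 𝕜 H₁] [CompleteSpace H₁]
    [NormedAddCommGroup H₂] [InnerProductSpace 𝕜 H₂] [CompleteSpace H₂]
    [NormedAddCommGroup U] [InnerProductSpace 𝕜 U] [CompleteSpace U] where
  A₁ : PosOp 𝕜 H₁
  A₂ : PosOp 𝕜 H₂
  B : U →L[𝕜] A₁.NegHalf
  C : H₂ →ₗ.[𝕜] H₁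
  embed_C : ContEmbeds A₂ C
  embed_Cadj : ContEmbeds A₁ C.adjoint

namespace CoupledData

variable {H₁ H₂ U : Type*}
  [NormedAddCommGroup H₁] [InnerProductSpace 𝕜 H₁] [CompleteSpace H₁]
  [NormedAddCommGroup H₂] [InnerProductSpace 𝕜 H₂] [CompleteSpace H₂]
  [NormedAddCommGroup U] [InnerProductSpace 𝕜 U] [CompleteSpace U]
  (D : CoupledData 𝕜 H₁ H₂ U)

/-- `C` on `H_{2,1/2}`. -/
def Chalf : D.A₂.Half →L[𝕜] H₁ := D.embed_C.restrict

/-- `C*` on `H_{1,1/2}`. -/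
def Cstar : D.A₁.Half →L[𝕜] H₂ := D.embed_Cadj.restrict

lemma dense_domain_C : Dense (D.C.domain : Set H₂) := by
  refine D.A₂.sqrt_spec.selfAdj.dense_domain.mono fun x hx => ?_
  exact D.embed_C.mem (⟨x, hx⟩ : D.A₂.sqrt.domain)

lemma inner_Cstar (u : D.A₁.Half) (v : D.A₂.Half) :
    inner 𝕜 (D.Cstar u) (D.A₂.incl v) = inner 𝕜 (D.A₁.incl u) (D.Chalf v) :=
  LinearPMap.adjoint_isFormalAdjoint D.dense_domain_C ⟨_, D.embed_Cadj.mem u⟩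
    ⟨_, D.embed_C.mem v⟩

/-- The operator `λ² + A₁ + λ² C (λ² + A₂)⁻¹ C*` from `H_{1,1/2}` to `H_{1,-1/2}`. -/
def operatorL (lam : ℝ) : D.A₁.Half →L[𝕜] D.A₁.NegHalf :=
  ((lam ^ 2 : ℝ) : 𝕜) • (D.A₁.embed ∘L D.A₁.incl) + D.A₁.energyOp +
    ((lam ^ 2 : ℝ) : 𝕜) •
      (D.A₁.embed ∘L D.Chalf ∘L D.A₂.resolvent (sq_nonneg lam) ∘L D.Cstar)

/-- `G(λ) = λ B* [λ² + A₁ + λ² C (λ² + A₂)⁻¹ C*]⁻¹ B`. -/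
def G (lam : ℝ) : U →L[𝕜] U :=
  (lam : 𝕜) • (adjControl D.B ∘L (D.operatorL lam).inverse ∘L D.B)

/-! #### The coupled system as a first order system -/

/-- The energy domain `H_{1,1/2} × H_{2,1/2} × H_{1,1/2} × H_{2,1/2}`; its elements are
`(w₁, w₂, ẇ₁, ẇ₂)`. -/
abbrev V : Type _ := D.A₁.Half × D.A₂.Half × D.A₁.Half × D.A₂.Half

/-- The space `H_{1,1/2} × H_{2,1/2} × H_{1,-1/2} × H_{2,-1/2}` in which the equations are read. -/
abbrev W : Type _ := D.A₁.Half × D.A₂.Half × D.A₁.NegHalf × D.A₂.NegHalf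

/-- A component of an element of `V`. -/
def p₁ : D.V →L[𝕜] D.A₁.Half := .fst 𝕜 _ _
/-- A component of an element of `V`. -/
def p₂ : D.V →L[𝕜] D.A₂.Half := .fst 𝕜 _ _ ∘L .snd 𝕜 _ _
/-- A component of an element of `V`. -/
def p₃ : D.V →L[𝕜] D.A₁.Half := .fst 𝕜 _ _ ∘L .snd 𝕜 _ _ ∘L .snd 𝕜 _ _
/-- A component of an element of `V`. -/
def p₄ : D.V →L[𝕜] D.A₂.Half := .snd 𝕜 _ _ ∘L .snd 𝕜 _ _ ∘L .snd 𝕜 _ _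

/-- The canonical embedding of `V` in `W`. -/
def J : D.V →L[𝕜] D.W :=
  D.p₁.prod (D.p₂.prod ((D.A₁.embed ∘L D.A₁.incl ∘L D.p₃).prod
    (D.A₂.embed ∘L D.A₂.incl ∘L D.p₄)))

/-- The generator
`(u₁, v₁, u₂, v₂) ↦ (u₂, v₂, -A₁ u₁ - C v₂, -A₂ v₁ + C* u₂)`, extended to `V`. -/
def gen : D.V →L[𝕜] D.W :=
  D.p₃.prod (D.p₄.prod
    ((-(D.A₁.energyOp ∘L D.p₁) - D.A₁.embed ∘L D.Chalf ∘L D.p₄).prod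
      (-(D.A₂.energyOp ∘L D.p₂) + D.A₂.embed ∘L D.Cstar ∘L D.p₃)))

/-- On `H_{1,1} × H_{2,1} × H_{1,1/2} × H_{2,1/2}` the extended generator is the generator in the
state space `H_{1,1/2} × H_{2,1/2} × H₁ × H₂`. -/
lemma gen_ofDomain (u₁ : D.A₁.op.domain) (v₁ : D.A₂.op.domain) (u₂ : D.A₁.Half)
    (v₂ : D.A₂.Half) :
    D.gen (D.A₁.ofDomain u₁, D.A₂.ofDomain v₁, u₂, v₂) =
      (u₂, v₂, D.A₁.embed (-D.A₁.op u₁ - D.Chalf v₂),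
        D.A₂.embed (-D.A₂.op v₁ + D.Cstar u₂)) := by
  rw [map_sub, map_add, map_neg, map_neg, ← D.A₁.energyOp_ofDomain u₁,
    ← D.A₂.energyOp_ofDomain v₁]
  rfl

/-- The control operator `u ↦ (0, 0, B u, 0)`. -/
def control : U →L[𝕜] D.W :=
  (0 : U →L[𝕜] D.A₁.Half).prod ((0 : U →L[𝕜] D.A₂.Half).prod
    (D.B.prod (0 : U →L[𝕜] D.A₂.NegHalf)))

/-- The observation `(w₁, w₂, ẇ₁, ẇ₂) ↦ B* ẇ₁`. -/
def observe : D.V →L[𝕜] U := adjControl D.B ∘L D.p₃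

/-- The transfer function of the coupled system `ẅ₁ + A₁ w₁ + B B* ẇ₁ + C ẇ₂ = 0`,
`ẅ₂ + A₂ w₂ - C* ẇ₁ = 0`, that is, of the open loop system `ẅ₁ + A₁ w₁ + C ẇ₂ = B u`,
`ẅ₂ + A₂ w₂ - C* ẇ₁ = 0`, `y = B* ẇ₁`. -/
def transfer (s : 𝕜) : U →L[𝕜] U :=
  transferFunction D.J D.gen D.control D.observe s

/-! #### The abstract second order system -/

/-- The product Hilbert space `H₁ × H₂`. -/
abbrev ProdSpace (_ : CoupledData 𝕜 H₁ H₂ U) : Type _ := WithLp 2 (H₁ × H₂)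

/-- `C* u + A₂^{1/2} v` for `u ∈ D(A₁)` and `v ∈ D(A₂^{1/2})`. -/
def flux (u : D.A₁.op.domain) (v : D.A₂.sqrt.domain) : H₂ :=
  D.Cstar (D.A₁.ofDomain u) + D.A₂.sqrt v

lemma flux_add (u u' : D.A₁.op.domain) (v v' : D.A₂.sqrt.domain) :
    D.flux (u + u') (v + v') = D.flux u v + D.flux u' v' := by
  simp only [flux, map_add, LinearPMap.map_add]
  abel

lemma flux_smul (c : 𝕜) (u : D.A₁.op.domain) (v : D.A₂.sqrt.domain) :
    D.flux (c • u) (c • v) = c • D.flux u v := by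
  simp only [flux, map_smul, LinearPMap.map_smul, smul_add]

/-- `D(A) = {(u, v) ∈ H_{1,1} × H_{2,1/2} : C* u + A₂^{1/2} v ∈ H_{2,1/2}}`. -/
def domainA : Submodule 𝕜 D.ProdSpace where
  carrier := {z | ∃ (hu : z.fst ∈ D.A₁.op.domain) (hv : z.snd ∈ D.A₂.sqrt.domain),
    D.flux ⟨z.fst, hu⟩ ⟨z.snd, hv⟩ ∈ D.A₂.sqrt.domain}
  zero_mem' := ⟨zero_mem _, zero_mem _, by
    have h := D.flux_smul 0 0 0
    rw [zero_smul, zero_smul, zero_smul] at h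
    have h2 : D.flux 0 0 ∈ D.A₂.sqrt.domain := by rw [h]; exact zero_mem _
    exact h2⟩
  add_mem' := by
    rintro x y ⟨hu, hv, hw⟩ ⟨hu', hv', hw'⟩
    refine ⟨add_mem hu hu', add_mem hv hv', ?_⟩
    have h := D.flux_add ⟨x.fst, hu⟩ ⟨y.fst, hu'⟩ ⟨x.snd, hv⟩ ⟨y.snd, hv'⟩
    exact (congrArg (· ∈ D.A₂.sqrt.domain) h).mpr (add_mem hw hw')
  smul_mem' := by
    rintro c x ⟨hu, hv, hw⟩
    refine ⟨Submodule.smul_mem _ c hu, Submodule.smul_mem _ c hv, ?_⟩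
    have h := D.flux_smul c ⟨x.fst, hu⟩ ⟨x.snd, hv⟩
    exact (congrArg (· ∈ D.A₂.sqrt.domain) h).mpr (Submodule.smul_mem _ c hw)

/-- The component `u` of an element `(u, v)` of `D(A)`. -/
def uPart : D.domainA →ₗ[𝕜] D.A₁.op.domain where
  toFun z := ⟨z.1.fst, z.2.1⟩
  map_add' _ _ := rfl
  map_smul' _ _ := rfl

/-- The component `v`. -/
def vPart : D.domainA →ₗ[𝕜] D.A₂.sqrt.domain where
  toFun z := ⟨z.1.snd, z.2.2.1⟩
  map_add' _ _ := rfl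
  map_smul' _ _ := rfl

/-- The element `w = C* u + A₂^{1/2} v` of `H_{2,1/2}`. -/
def wPart : D.domainA →ₗ[𝕜] D.A₂.Half where
  toFun z := (⟨D.flux (D.uPart z) (D.vPart z), z.2.2.2⟩ : D.A₂.sqrt.domain)
  map_add' x y := Subtype.ext (D.flux_add (D.uPart x) (D.uPart y) (D.vPart x) (D.vPart y))
  map_smul' c x := Subtype.ext (D.flux_smul c (D.uPart x) (D.vPart x))

/-- The operator `A (u, v) = (A₁ u + C (C* u + A₂^{1/2} v), A₂^{1/2} (C* u + A₂^{1/2} v))`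
in `H₁ × H₂` with domain `D(A)`. -/
def operatorA : D.ProdSpace →ₗ.[𝕜] D.ProdSpace where
  domain := D.domainA
  toFun := (WithLp.linearEquiv 2 𝕜 (H₁ × H₂)).symm.toLinearMap ∘ₗ
    ((D.A₁.op.toFun ∘ₗ D.uPart + D.Chalf.toLinearMap ∘ₗ D.wPart).prod
      (D.A₂.halfMap ∘ₗ D.wPart))

lemma operatorA_fst (z : D.domainA) :
    (D.operatorA z).fst = D.A₁.op (D.uPart z) + D.Chalf (D.wPart z) := rfl

lemma operatorA_snd (z : D.domainA) : (D.operatorA z).snd = D.A₂.halfMap (D.wPart z) := rfl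

lemma incl_wPart (z : D.domainA) : D.A₂.incl (D.wPart z) =
    D.Cstar (D.A₁.ofDomain (D.uPart z)) + D.A₂.sqrt (D.vPart z) := rfl

lemma inner_operatorA (x y : D.domainA) :
    inner 𝕜 (D.operatorA x) (y : D.ProdSpace) =
      inner 𝕜 (D.A₁.ofDomain (D.uPart x)) (D.A₁.ofDomain (D.uPart y)) +
        inner 𝕜 (D.A₂.incl (D.wPart x)) (D.A₂.incl (D.wPart y)) := by
  change inner 𝕜 (D.operatorA x).fst (y : D.ProdSpace).fst +
    inner 𝕜 (D.operatorA x).snd (y : D.ProdSpace).snd = _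
  rw [operatorA_fst, operatorA_snd, inner_add_left, D.incl_wPart y, inner_add_right]
  have e1 : inner 𝕜 (D.A₁.op (D.uPart x)) (y : D.ProdSpace).fst =
      inner 𝕜 (D.A₁.ofDomain (D.uPart x)) (D.A₁.ofDomain (D.uPart y)) :=
    D.A₁.inner_op (D.uPart x) (D.A₁.ofDomain (D.uPart y))
  have e2 : inner 𝕜 (D.Chalf (D.wPart x)) (y : D.ProdSpace).fst =
      inner 𝕜 (D.A₂.incl (D.wPart x)) (D.Cstar (D.A₁.ofDomain (D.uPart y))) := by
    rw [← inner_conj_symm, ← inner_conj_symm (D.A₂.incl _)]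
    exact congrArg _ (D.inner_Cstar (D.A₁.ofDomain (D.uPart y)) (D.wPart x)).symm
  have e3 : inner 𝕜 (D.A₂.halfMap (D.wPart x)) (y : D.ProdSpace).snd =
      inner 𝕜 (D.A₂.incl (D.wPart x)) (D.A₂.sqrt (D.vPart y)) :=
    selfAdj_symm D.A₂.sqrt_spec.selfAdj (D.wPart x) (D.vPart y)
  rw [e1, e2, e3]
  ring

lemma operatorA_symm (x y : D.domainA) :
    inner 𝕜 (D.operatorA x) (y : D.ProdSpace) = inner 𝕜 (x : D.ProdSpace) (D.operatorA y) := by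
  rw [← inner_conj_symm (x : D.ProdSpace), inner_operatorA, inner_operatorA, map_add,
    inner_conj_symm, inner_conj_symm]

lemma operatorA_solve (f : H₁) (w : D.A₂.Half) : ∃ z : D.domainA,
    D.wPart z = w ∧ D.A₁.op (D.uPart z) = f := by
  obtain ⟨u, hu⟩ := D.A₁.op_surjective f
  obtain ⟨v, hv⟩ := D.A₂.sqrt_surjective (D.A₂.incl w - D.Cstar (D.A₁.ofDomain u))
  have hflux : D.flux u v = D.A₂.incl w := by rw [flux, hv]; abel
  have hmem : D.flux u v ∈ D.A₂.sqrt.domain := by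
    rw [hflux]
    exact Subtype.prop (p := (· ∈ D.A₂.sqrt.domain)) w
  exact ⟨⟨WithLp.toLp 2 (u, v), u.2, v.2, hmem⟩, Subtype.ext hflux, hu⟩

lemma operatorA_surjective (f : D.ProdSpace) : ∃ z : D.domainA, D.operatorA z = f := by
  obtain ⟨w, hw⟩ := D.A₂.sqrt_surjective f.snd
  obtain ⟨z, hz, hz'⟩ := D.operatorA_solve (f.fst - D.Chalf w) w
  refine ⟨z, ?_⟩
  have e1 : (D.operatorA z).fst = f.fst := by rw [operatorA_fst, hz', hz]; abel
  have e2 : (D.operatorA z).snd = f.snd := by rw [operatorA_snd, hz]; exact hw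
  exact WithLp.ofLp_injective 2 (Prod.ext e1 e2)

lemma operatorA_bddBelow : ∃ m : ℝ, 0 < m ∧ ∀ z : D.domainA,
    m * ‖(z : D.ProdSpace)‖ ^ 2 ≤ RCLike.re (inner 𝕜 (D.operatorA z) (z : D.ProdSpace)) := by
  obtain ⟨k, hk, h1⟩ := D.A₁.sqrt_bound
  obtain ⟨l, hl, h2⟩ := D.A₂.sqrt_bound
  set c := ‖D.Cstar‖ with hc
  have hc0 : 0 ≤ c := norm_nonneg _
  refine ⟨(k ^ 2 + 2 * l ^ 2 * (1 + c ^ 2))⁻¹, by positivity, fun z => ?_⟩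
  set a := ‖D.A₁.ofDomain (D.uPart z)‖ with ha
  set b := ‖D.A₂.incl (D.wPart z)‖ with hb
  have e : RCLike.re (inner 𝕜 (D.operatorA z) (z : D.ProdSpace)) = a ^ 2 + b ^ 2 := by
    rw [inner_operatorA, map_add, inner_self_eq_norm_sq, inner_self_eq_norm_sq]
  have ea : ‖(z : D.ProdSpace).fst‖ ≤ k * a := h1 (D.A₁.ofDomain (D.uPart z))
  have eb : ‖(z : D.ProdSpace).snd‖ ≤ l * (b + c * a) := by
    refine (h2 (D.vPart z)).trans (mul_le_mul_of_nonneg_left ?_ hl.le)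
    have : D.A₂.sqrt (D.vPart z) =
        D.A₂.incl (D.wPart z) - D.Cstar (D.A₁.ofDomain (D.uPart z)) := by
      rw [incl_wPart]; abel
    rw [this]
    exact (norm_sub_le _ _).trans (add_le_add le_rfl (D.Cstar.le_opNorm _))
  rw [e, inv_mul_le_iff₀ (by positivity), WithLp.prod_norm_sq_eq_of_L2]
  have ha0 : 0 ≤ a := norm_nonneg _
  have hb0 : 0 ≤ b := norm_nonneg _
  have q1 : ‖(z : D.ProdSpace).fst‖ ^ 2 ≤ (k * a) ^ 2 := pow_le_pow_left₀ (norm_nonneg _) ea 2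
  have q2 : ‖(z : D.ProdSpace).snd‖ ^ 2 ≤ (l * (b + c * a)) ^ 2 :=
    pow_le_pow_left₀ (norm_nonneg _) eb 2
  have q3 : (b + c * a) ^ 2 ≤ 2 * (1 + c ^ 2) * (a ^ 2 + b ^ 2) := by
    nlinarith [sq_nonneg (b - c * a), sq_nonneg (c * b), sq_nonneg a]
  have q4 : (l * (b + c * a)) ^ 2 ≤ l ^ 2 * (2 * (1 + c ^ 2) * (a ^ 2 + b ^ 2)) := by
    rw [mul_pow]; exact mul_le_mul_of_nonneg_left q3 (sq_nonneg l)
  nlinarith [mul_nonneg (sq_nonneg k) (sq_nonneg b)]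

/-- `A` as a positive self-adjoint operator. -/
def A : PosOp 𝕜 D.ProdSpace where
  op := D.operatorA
  selfAdj := isSelfAdjoint_of_symm_surj D.operatorA_symm D.operatorA_surjective
  bddBelow := D.operatorA_bddBelow

lemma exists_fst_mem (ζ : D.A.Half) :
    ∃ h : (D.A.incl ζ).fst ∈ D.A₁.sqrt.domain, ‖D.A₁.sqrt ⟨_, h⟩‖ ≤ ‖ζ‖ := by
  have key : ∀ x : D.A₁.sqrt.domain,
      ‖(inner 𝕜 (D.A.incl ζ).fst (D.A₁.sqrt x) : 𝕜)‖ ≤ ‖ζ‖ * ‖(x : H₁)‖ := by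
    intro x
    obtain ⟨z, hz, hz'⟩ := D.operatorA_solve (D.A₁.sqrt x) 0
    have e1 : D.operatorA z = WithLp.toLp 2 (D.A₁.sqrt x, 0) := by
      refine WithLp.ofLp_injective 2 (Prod.ext ?_ ?_)
      · exact (D.operatorA_fst z).trans (by rw [hz, hz', map_zero, add_zero])
      · exact (D.operatorA_snd z).trans (by rw [hz, map_zero])
    have e2 : inner 𝕜 (D.operatorA z) (D.A.incl ζ) =
        inner 𝕜 (D.A₁.sqrt x) (D.A.incl ζ).fst := by
      rw [e1, WithLp.prod_inner_apply]
      simp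
    have e3 : inner 𝕜 (D.operatorA z) (D.A.incl ζ) = inner 𝕜 (D.A.ofDomain z) ζ :=
      D.A.inner_op z ζ
    have e4 : ‖D.A₁.ofDomain (D.uPart z)‖ ≤ ‖(x : H₁)‖ := by
      have h1 := D.A₁.sqrt_sqrt (D.uPart z).2
      have h2 : (⟨_, D.A₁.sqrt_mem (D.uPart z).2⟩ : D.A₁.sqrt.domain) = x :=
        D.A₁.sqrt_injective (h1.trans hz')
      exact le_of_eq (congrArg (fun y : D.A₁.sqrt.domain => ‖(y : H₁)‖) h2)
    have e5 : ‖D.A.ofDomain z‖ ≤ ‖(x : H₁)‖ := by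
      have h1 : ‖D.A.ofDomain z‖ ^ 2 = ‖D.A₁.ofDomain (D.uPart z)‖ ^ 2 := by
        rw [← D.A.re_inner_op z]
        have := D.inner_operatorA z z
        rw [hz, map_zero, inner_zero_left, add_zero] at this
        exact (congrArg RCLike.re this).trans (inner_self_eq_norm_sq _)
      refine le_trans (le_of_eq ?_) e4
      exact (pow_left_inj₀ (norm_nonneg _) (norm_nonneg _) two_ne_zero).mp h1
    rw [← inner_conj_symm, RCLike.norm_conj, ← e2, e3]
    refine (norm_inner_le_norm _ _).trans ?_
    rw [mul_comm]
    exact mul_le_mul_of_nonneg_left e5 (norm_nonneg _)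
  have hmem : (D.A.incl ζ).fst ∈ D.A₁.sqrt.adjoint.domain := by
    rw [LinearPMap.mem_adjoint_domain_iff]
    exact (LinearMap.mkContinuous _ ‖ζ‖ key).continuous
  have hsa : D.A₁.sqrt.adjoint = D.A₁.sqrt :=
    LinearPMap.isSelfAdjoint_def.mp D.A₁.sqrt_spec.selfAdj
  have h : (D.A.incl ζ).fst ∈ D.A₁.sqrt.domain := by rw [← hsa]; exact hmem
  refine ⟨h, ?_⟩
  set g := D.A₁.sqrt ⟨_, h⟩ with hg
  have hle : ∀ x : D.A₁.sqrt.domain, ‖(inner 𝕜 g (x : H₁) : 𝕜)‖ ≤ ‖ζ‖ * ‖(x : H₁)‖ := by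
    intro x
    rw [hg, selfAdj_symm D.A₁.sqrt_spec.selfAdj]
    exact key x
  have hle' : ∀ y : H₁, ‖(inner 𝕜 g y : 𝕜)‖ ≤ ‖ζ‖ * ‖y‖ := by
    intro y
    have hcl : IsClosed {y : H₁ | ‖(inner 𝕜 g y : 𝕜)‖ ≤ ‖ζ‖ * ‖y‖} :=
      isClosed_le (by fun_prop) (by fun_prop)
    exact hcl.closure_subset_iff.mpr (fun x hx => hle ⟨x, hx⟩)
      (D.A₁.sqrt_spec.selfAdj.dense_domain y)
  have h3 := hle' g
  rw [inner_self_eq_norm_sq_to_K, norm_pow, RCLike.norm_ofReal, abs_norm, sq] at h3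
  by_cases hz : ‖g‖ = 0
  · rw [hz]; exact norm_nonneg _
  · exact le_of_mul_le_mul_right h3 (lt_of_le_of_ne (norm_nonneg _) (Ne.symm hz))

/-- The first component `D(A^{1/2}) → H_{1,1/2}`, `(x, y) ↦ x`. -/
def halfFst : D.A.Half →L[𝕜] D.A₁.Half :=
  LinearMap.mkContinuous
    (⟨⟨fun ζ => (⟨(D.A.incl ζ).fst, (D.exists_fst_mem ζ).1⟩ : D.A₁.sqrt.domain),
      fun _ _ => rfl⟩, fun _ _ => rfl⟩ : D.A.Half →ₗ[𝕜] D.A₁.Half) 1 fun ζ => by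
    rw [one_mul]
    exact (D.exists_fst_mem ζ).2

lemma incl_halfFst (ζ : D.A.Half) : D.A₁.incl (D.halfFst ζ) = (D.A.incl ζ).fst := rfl

/-- The control operator `𝓑₀ u = (B u, 0)`, from `U` to the dual of `D(A^{1/2})`:
`⟨𝓑₀ u, (x, y)⟩ = ⟨B u, x⟩`. -/
def B₀ : U →L[𝕜] D.A.NegHalf := (D.B.flip.comp D.halfFst).flip

lemma B₀_apply (u : U) (ζ : D.A.Half) : D.B₀ u ζ = D.B u (D.halfFst ζ) := rfl

end CoupledData

end CoupledWave

end

noncomputable section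

/-! ### Riesz representation and the Lax–Milgram theorem -/

namespace ContinuousLinearMap

variable {𝕜 : Type*} [RCLike 𝕜]

/-! Write `L(λ)` for `operatorL` and `R = (λ² + A₂)⁻¹`. The form of `L(λ)` at `x` has real part
`λ²‖x‖² + ‖A₁^{1/2} x‖² + λ² Re ⟨R C* x, C* x⟩`, since `C` can be moved to the other side as `C*`.
As `R` is nonnegative, this dominates the squared norm of `H_{1,1/2}`, and Lax–Milgram gives (i).
The same argument inverts `λ² + A : H_{1/2} → H_{-1/2}` for every positive self-adjoint `A`.

For the coupled system, `λ - 𝓐` is inverted by block elimination (`CoupledData.shifted_eq_iff`): the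
first two rows give the velocities, the fourth gives `v₁` through `R`, and what remains in the third
row is an equation `L(λ) u₁ = …`. With data `(0, 0, B u, 0)` its right-hand side is `B u`, and the
observed velocity is `λ u₁`, which yields `G(λ)`.

For the second order system, elimination of the velocity leaves `(λ² + A) ζ = 𝓑₀ u` with `ζ = (ξ,
v)`. Formally, the second component reads `λ² v + A₂^{1/2}(C* ξ + A₂^{1/2} v) = 0`. Writing `v =
A₂^{1/2} p` gives `p = -R C* ξ`, hence `C* ξ + A₂^{1/2} v = λ² R C* ξ`, and the first component
becomes `L(λ) ξ = B u`. The equation only holds in `D(A^{1/2})*`, so both steps are done weakly,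
against two families of vectors of `D(A)` (`snd_eq_of_energyShift_eq` and `operatorL_halfFst`).
Bijective bounded operators have bounded inverses by the open mapping theorem. -/

lemma isInvertible_of_bijective {V W : Type*} [NormedAddCommGroup V] [NormedSpace 𝕜 V]
    [CompleteSpace V] [NormedAddCommGroup W] [NormedSpace 𝕜 W] [CompleteSpace W]
    {T : V →L[𝕜] W} (hT : Function.Bijective T) : T.IsInvertible :=
  ⟨ContinuousLinearEquiv.ofBijective T (LinearMap.ker_eq_bot.mpr hT.1)
    (LinearMap.range_eq_top.mpr hT.2), ContinuousLinearEquiv.coe_ofBijective _ _ _⟩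

variable {E : Type*} [NormedAddCommGroup E] [InnerProductSpace 𝕜 E] [CompleteSpace E]

/-- The Riesz representation theorem for conjugate-linear functionals. -/
lemma isInvertible_innerSLFlip : (innerSLFlip 𝕜 : E →L[𝕜] E →L⋆[𝕜] 𝕜).IsInvertible := by
  refine isInvertible_of_bijective ⟨?_, fun f => ?_⟩
  · rw [injective_iff_map_eq_zero]
    intro x hx
    have h := congrArg (fun g : E →L⋆[𝕜] 𝕜 => g x) hx
    exact inner_self_eq_zero.mp h
  -- Conjugating the values of `f` makes it linear, so that the usual Riesz theorem applies.
  · refine ⟨(InnerProductSpace.toDual 𝕜 E).symm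
      (((starL 𝕜 : 𝕜 ≃L⋆[𝕜] 𝕜) : 𝕜 →L⋆[𝕜] 𝕜).comp f), ?_⟩
    ext x
    rw [innerSLFlip_apply_apply, ← inner_conj_symm, InnerProductSpace.toDual_symm_apply]
    simp

/-- The Lax–Milgram theorem for sesquilinear forms. -/
lemma isInvertible_of_coercive {T : E →L[𝕜] E →L⋆[𝕜] 𝕜}
    (hT : ∀ x, ‖x‖ ^ 2 ≤ RCLike.re (T x x)) : T.IsInvertible := by
  have hR := isInvertible_innerSLFlip (𝕜 := 𝕜) (E := E)
  -- Through the Riesz map, `T` becomes an operator `S` on `E` itself, and coercivity becomes `‖x‖²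
  -- ≤ |⟨S x, x⟩|`.
  set S : E →L[𝕜] E := (innerSLFlip 𝕜).inverse ∘L T with hS
  have hTS : T = innerSLFlip 𝕜 ∘L S := by
    ext1 x
    exact (hR.self_apply_inverse (T x)).symm
  have hu : IsUnit S := by
    refine isUnit_of_forall_le_norm_inner_map S one_pos fun x => ?_
    have h1 := hT x
    rw [hTS] at h1
    rw [NNReal.coe_one, mul_one, ← inner_conj_symm, RCLike.norm_conj]
    exact h1.trans (RCLike.re_le_norm _)
  rw [hTS]
  exact hR.comp (isInvertible_of_bijective (isUnit_iff_bijective.mp hu))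

end ContinuousLinearMap

namespace CoupledWave

variable {𝕜 : Type*} [RCLike 𝕜]
variable {H : Type*} [NormedAddCommGroup H] [InnerProductSpace 𝕜 H] [CompleteSpace H]

/-! ### The extension of `μ + A` to the energy space -/

namespace PosOp

variable (A : PosOp 𝕜 H)

lemma smul_zero_negHalf (c : 𝕜) : c • (0 : A.NegHalf) = 0 := by
  ext ζ
  exact mul_zero c

/-- The bounded extension `μ + A : H_{1/2} → H_{-1/2}`. -/
def energyShift (μ : ℝ) : A.Half →L[𝕜] A.NegHalf :=
  (μ : 𝕜) • (A.embed ∘L A.incl) + A.energyOp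

lemma energyShift_apply (μ : ℝ) (x : A.Half) :
    A.energyShift μ x = (μ : 𝕜) • A.embed (A.incl x) + A.energyOp x := rfl

lemma re_energyShift (μ : ℝ) (x : A.Half) :
    RCLike.re (A.energyShift μ x x) = μ * ‖A.incl x‖ ^ 2 + ‖x‖ ^ 2 := by
  have h : A.energyShift μ x x = (μ : 𝕜) * inner 𝕜 (A.incl x) (A.incl x) + inner 𝕜 x x := rfl
  rw [h, map_add, RCLike.re_ofReal_mul, inner_self_eq_norm_sq, inner_self_eq_norm_sq]

/-- The form of `A` is exactly the squared norm of `H_{1/2}`, so coercivity holds with constant one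
and `μ ≥ 0` only adds to it. -/
lemma energyShift_isInvertible {μ : ℝ} (hμ : 0 ≤ μ) : (A.energyShift μ).IsInvertible :=
  ContinuousLinearMap.isInvertible_of_coercive fun x => by
    rw [re_energyShift]
    exact le_add_of_nonneg_left (by positivity)

/-- The extension agrees with `A` on `D(A)`, where the resolvent takes its values. Thus equations
read in `H_{-1/2}` can be solved by the resolvent of `H` when their data lie in `H`. -/
lemma energyShift_resolvent {μ : ℝ} (hμ : 0 ≤ μ) (f : H) :
    A.energyShift μ (A.resolvent hμ f) = A.embed f := by
  obtain ⟨x, hx, hf⟩ := A.resolvent_spec hμ f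
  rw [energyShift_apply, hx, energyOp_ofDomain, ← map_smul, ← map_add, ← hf]
  rfl

lemma resolvent_eq {μ : ℝ} (hμ : 0 ≤ μ) {f : H} (x : A.op.domain)
    (hx : (μ : 𝕜) • (x : H) + A.op x = f) : A.resolvent hμ f = A.ofDomain x := by
  obtain ⟨y, hy, hf⟩ := A.resolvent_spec hμ f
  rw [hy, A.shift_injective hμ (hf.trans hx.symm)]

/-- With `x = (μ + A)⁻¹ f`, this pairing has the real part of the form of `μ + A` at `x`. It gives
the sign of the coupling term in `operatorL`. -/
lemma re_inner_resolvent_nonneg {μ : ℝ} (hμ : 0 ≤ μ) (f : H) :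
    0 ≤ RCLike.re (inner 𝕜 f (A.incl (A.resolvent hμ f))) := by
  have h : RCLike.re (A.energyShift μ (A.resolvent hμ f) (A.resolvent hμ f)) =
      RCLike.re (inner 𝕜 f (A.incl (A.resolvent hμ f))) := by
    rw [energyShift_resolvent, embed_apply, ← inner_conj_symm, RCLike.conj_re]
  rw [← h, re_energyShift]
  positivity

/-- `D(A)` is dense in `H_{1/2}`: a functional on `H_{1/2}` is determined on `D(A)`. -/
lemma negHalf_ext {f g : A.NegHalf} (h : ∀ x, f (A.ofDomain x) = g (A.ofDomain x)) : f = g := by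
  -- If `ζ` represents `f - g` and `A x = ζ`, then testing with `x` gives `0 = ⟨x, ζ⟩_{1/2} = ⟨A x,
  -- ζ⟩ = ‖ζ‖²`.
  obtain ⟨ζ, hζ⟩ := (ContinuousLinearMap.isInvertible_innerSLFlip (𝕜 := 𝕜)).surjective (f - g)
  obtain ⟨x, hx⟩ := A.op_surjective (A.incl ζ)
  have h1 : inner 𝕜 (A.ofDomain x) ζ = (0 : 𝕜) := by
    rw [← innerSLFlip_apply_apply, hζ]
    exact sub_eq_zero.mpr (h x)
  have h2 : inner 𝕜 (A.incl ζ) (A.incl ζ) = (0 : 𝕜) := by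
    have h3 : inner 𝕜 (A.op x) (A.incl ζ) = (0 : 𝕜) := (A.inner_op x ζ).trans h1
    rwa [hx] at h3
  have h3 : ζ = 0 := Subtype.ext (inner_self_eq_zero.mp h2)
  rw [h3, map_zero] at hζ
  exact (sub_eq_zero.mp hζ.symm)

end PosOp

/-! ### Resolvent and transfer function of a second order system -/

namespace SecondOrder

variable {U : Type*} [NormedAddCommGroup U] [InnerProductSpace 𝕜 U] [CompleteSpace U]
variable (A : PosOp 𝕜 H)

/-- The first row determines the velocity `y`; inserting it in the second row `λ y + A x = g` leaves
an equation for `x` alone. -/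
lemma shifted_eq_iff (lam : ℝ) (x y f : A.Half) (g : A.NegHalf) :
    shifted (J A) (gen A) (lam : 𝕜) (x, y) = (f, g) ↔
      y = (lam : 𝕜) • x - f ∧
        A.energyShift (lam ^ 2) x = g + (lam : 𝕜) • A.embed (A.incl f) := by
  have e : shifted (J A) (gen A) (lam : 𝕜) (x, y) =
      ((lam : 𝕜) • x - y, (lam : 𝕜) • A.embed (A.incl y) - -A.energyOp x) := rfl
  rw [e, Prod.mk.injEq, PosOp.energyShift_apply]
  have h1 : (lam : 𝕜) • x - y = f ↔ y = (lam : 𝕜) • x - f := by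
    constructor <;> rintro rfl <;> abel
  rw [h1]
  refine and_congr_right fun hy => ?_
  rw [hy, ← sub_eq_zero, ← sub_eq_zero (b := g + _)]
  refine iff_of_eq (congrArg (· = 0) ?_)
  simp only [map_sub, map_smul, RCLike.ofReal_pow]
  module

lemma shifted_isInvertible (lam : ℝ) : (shifted (J A) (gen A) (lam : 𝕜)).IsInvertible := by
  have hQ := A.energyShift_isInvertible (sq_nonneg lam)
  refine ContinuousLinearMap.isInvertible_of_bijective ⟨?_, ?_⟩
  · rw [injective_iff_map_eq_zero]
    rintro ⟨x, y⟩ h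
    obtain ⟨rfl, hx⟩ := (shifted_eq_iff A lam x y 0 0).mp h
    rw [map_zero, map_zero, PosOp.smul_zero_negHalf, add_zero] at hx
    obtain rfl : x = 0 := hQ.injective (hx.trans (map_zero _).symm)
    simp
  · rintro ⟨f, g⟩
    exact ⟨_, (shifted_eq_iff A lam _ _ f g).mpr ⟨rfl, hQ.self_apply_inverse _⟩⟩

variable {A}

/-- The data `(0, 𝓑₀ u)` force `y = λ x`; as the velocity is observed, this is the source of the
factor `λ`. -/
lemma transfer_apply (B₀ : U →L[𝕜] A.NegHalf) (lam : ℝ) (u : U) :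
    transfer B₀ (lam : 𝕜) u =
      (lam : 𝕜) • adjControl B₀ ((A.energyShift (lam ^ 2)).inverse (B₀ u)) := by
  have h : (shifted (J A) (gen A) (lam : 𝕜)).inverse (0, B₀ u) =
      ((A.energyShift (lam ^ 2)).inverse (B₀ u),
        (lam : 𝕜) • (A.energyShift (lam ^ 2)).inverse (B₀ u)) := by
    rw [(shifted_isInvertible A lam).inverse_apply_eq, eq_comm, shifted_eq_iff]
    refine ⟨(sub_zero _).symm, ?_⟩
    rw [(A.energyShift_isInvertible (sq_nonneg lam)).self_apply_inverse]
    simp [PosOp.smul_zero_negHalf]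
  rw [← map_smul]
  exact congrArg (fun p => adjControl B₀ p.2) h

end SecondOrder

/-! ### Block elimination for the coupled system -/

namespace CoupledData

variable {H₁ H₂ U : Type*}
  [NormedAddCommGroup H₁] [InnerProductSpace 𝕜 H₁] [CompleteSpace H₁]
  [NormedAddCommGroup H₂] [InnerProductSpace 𝕜 H₂] [CompleteSpace H₂]
  [NormedAddCommGroup U] [InnerProductSpace 𝕜 U] [CompleteSpace U]
  (D : CoupledData 𝕜 H₁ H₂ U)

lemma operatorL_apply (lam : ℝ) (x : D.A₁.Half) :
    D.operatorL lam x = D.A₁.energyShift (lam ^ 2) x + ((lam ^ 2 : ℝ) : 𝕜) •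
      D.A₁.embed (D.Chalf (D.A₂.resolvent (sq_nonneg lam) (D.Cstar x))) := rfl

/-- Once `C` is moved across by `inner_Cstar`, the coupling term is `λ²⟨R C* x, C* x⟩` with `R`
nonnegative, so it does not harm the coercivity of `λ² + A₁`. -/
lemma operatorL_isInvertible (lam : ℝ) : (D.operatorL lam).IsInvertible :=
  ContinuousLinearMap.isInvertible_of_coercive fun x => by
    have h : D.operatorL lam x x = D.A₁.energyShift (lam ^ 2) x x + ((lam ^ 2 : ℝ) : 𝕜) *
        inner 𝕜 (D.A₁.incl x) (D.Chalf (D.A₂.resolvent (sq_nonneg lam) (D.Cstar x))) := rfl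
    rw [h, ← inner_Cstar, map_add, RCLike.re_ofReal_mul, PosOp.re_energyShift]
    have := mul_nonneg (sq_nonneg lam)
      (D.A₂.re_inner_resolvent_nonneg (sq_nonneg lam) (D.Cstar x))
    nlinarith [mul_nonneg (sq_nonneg lam) (sq_nonneg ‖D.A₁.incl x‖)]

/-- Here `k` is the part of `v₁` that does not depend on `u₁`. It enters as a solution of an
equation because `g₂` lies in `H_{2,-1/2}`, whereas `resolvent` acts on `H₂` only. -/
lemma shifted_eq_iff (lam : ℝ) (u₁ u₂ f₁ : D.A₁.Half) (v₁ v₂ f₂ : D.A₂.Half)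
    (g₁ : D.A₁.NegHalf) (g₂ : D.A₂.NegHalf) {k : D.A₂.Half}
    (hk : D.A₂.energyShift (lam ^ 2) k =
      g₂ + (lam : 𝕜) • D.A₂.embed (D.A₂.incl f₂) - D.A₂.embed (D.Cstar f₁)) :
    shifted D.J D.gen (lam : 𝕜) (u₁, v₁, u₂, v₂) = (f₁, f₂, g₁, g₂) ↔
      u₂ = (lam : 𝕜) • u₁ - f₁ ∧ v₂ = (lam : 𝕜) • v₁ - f₂ ∧
      v₁ = k + (lam : 𝕜) • D.A₂.resolvent (sq_nonneg lam) (D.Cstar u₁) ∧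
      D.operatorL lam u₁ = g₁ + (lam : 𝕜) • D.A₁.embed (D.A₁.incl f₁) +
        D.A₁.embed (D.Chalf f₂) - (lam : 𝕜) • D.A₁.embed (D.Chalf k) := by
  have e : shifted D.J D.gen (lam : 𝕜) (u₁, v₁, u₂, v₂) =
      ((lam : 𝕜) • u₁ - u₂, (lam : 𝕜) • v₁ - v₂,
        (lam : 𝕜) • D.A₁.embed (D.A₁.incl u₂) - (-D.A₁.energyOp u₁ - D.A₁.embed (D.Chalf v₂)),
        (lam : 𝕜) • D.A₂.embed (D.A₂.incl v₂) -
          (-D.A₂.energyOp v₁ + D.A₂.embed (D.Cstar u₂))) := rfl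
  rw [e, Prod.mk.injEq, Prod.mk.injEq, Prod.mk.injEq]
  have h1 : (lam : 𝕜) • u₁ - u₂ = f₁ ↔ u₂ = (lam : 𝕜) • u₁ - f₁ := by
    constructor <;> rintro rfl <;> abel
  have h2 : (lam : 𝕜) • v₁ - v₂ = f₂ ↔ v₂ = (lam : 𝕜) • v₁ - f₂ := by
    constructor <;> rintro rfl <;> abel
  rw [h1, h2]
  refine and_congr_right fun hu => and_congr_right fun hv => ?_
  -- The fourth row goes before the third, which needs the resulting value of `v₁`.
  rw [and_comm]
  have h3 : (lam : 𝕜) • D.A₂.embed (D.A₂.incl v₂) -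
        (-D.A₂.energyOp v₁ + D.A₂.embed (D.Cstar u₂)) = g₂ ↔
      v₁ = k + (lam : 𝕜) • D.A₂.resolvent (sq_nonneg lam) (D.Cstar u₁) := by
    -- Apply the injective operator `λ² + A₂` to both sides of the formula for `v₁`.
    rw [← (D.A₂.energyShift_isInvertible (sq_nonneg lam)).injective.eq_iff, map_add, map_smul,
      PosOp.energyShift_resolvent, hk, PosOp.energyShift_apply, ← sub_eq_zero, hu, hv]
    conv_rhs => rw [← sub_eq_zero]
    refine iff_of_eq (congrArg (· = 0) ?_)
    simp only [map_sub, map_smul, RCLike.ofReal_pow]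
    module
  rw [h3]
  refine and_congr_right fun hv₁ => ?_
  rw [operatorL_apply, PosOp.energyShift_apply, hu, hv, hv₁, ← sub_eq_zero]
  conv_rhs => rw [← sub_eq_zero]
  refine iff_of_eq (congrArg (· = 0) ?_)
  simp only [map_sub, map_add, map_smul, RCLike.ofReal_pow]
  module

lemma shifted_isInvertible (lam : ℝ) : (shifted D.J D.gen (lam : 𝕜)).IsInvertible := by
  have hL := D.operatorL_isInvertible lam
  have hQ := D.A₂.energyShift_isInvertible (sq_nonneg lam)
  refine ContinuousLinearMap.isInvertible_of_bijective ⟨?_, ?_⟩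
  · rw [injective_iff_map_eq_zero]
    rintro ⟨u₁, v₁, u₂, v₂⟩ h
    obtain ⟨rfl, rfl, rfl, hu⟩ :=
      (D.shifted_eq_iff lam u₁ u₂ 0 v₁ v₂ 0 0 0 (k := 0) (by simp [PosOp.smul_zero_negHalf])).mp h
    obtain rfl : u₁ = 0 := hL.injective (by rw [hu]; simp [PosOp.smul_zero_negHalf])
    simp
  · rintro ⟨f₁, f₂, g₁, g₂⟩
    exact ⟨_, (D.shifted_eq_iff lam _ _ f₁ _ _ f₂ g₁ g₂ (hQ.self_apply_inverse _)).mpr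
      ⟨rfl, rfl, rfl, hL.self_apply_inverse _⟩⟩

lemma G_apply (lam : ℝ) (u : U) :
    D.G lam u = (lam : 𝕜) • adjControl D.B ((D.operatorL lam).inverse (D.B u)) := rfl

lemma transfer_eq_G (lam : ℝ) : D.transfer (lam : 𝕜) = D.G lam := by
  ext1 u
  set x := (D.operatorL lam).inverse (D.B u) with hx
  set y := D.A₂.resolvent (sq_nonneg lam) (D.Cstar x) with hy
  -- For these data `k = 0`, so `v₁ = λ y`, and the velocities are `λ` times the positions.
  have h : (shifted D.J D.gen (lam : 𝕜)).inverse (0, 0, D.B u, 0) =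
      (x, (lam : 𝕜) • y, (lam : 𝕜) • x, (lam : 𝕜) • (lam : 𝕜) • y) := by
    rw [(D.shifted_isInvertible lam).inverse_apply_eq, eq_comm,
      D.shifted_eq_iff lam _ _ _ _ _ _ _ _ (k := 0) (by simp [PosOp.smul_zero_negHalf])]
    refine ⟨(sub_zero _).symm, (sub_zero _).symm, (zero_add _).symm, ?_⟩
    rw [hx, (D.operatorL_isInvertible lam).self_apply_inverse]
    simp [PosOp.smul_zero_negHalf]
  rw [G_apply, ← map_smul]
  exact congrArg (fun p => adjControl D.B p.2.2.1) h

/-! ### Reduction of the abstract second order system to `operatorL` -/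

lemma halfFst_ofDomain (z : D.domainA) :
    D.halfFst (D.A.ofDomain z) = D.A₁.ofDomain (D.uPart z) := rfl

/-- The weak form of `(μ + A) ζ = 𝓑₀ u`, tested with an element of `D(A)`. -/
lemma energyShift_ofDomain (μ : ℝ) (ζ : D.A.Half) (z : D.domainA) :
    D.A.energyShift μ ζ (D.A.ofDomain z) =
      (μ : 𝕜) * (inner 𝕜 (D.uPart z : H₁) (D.A.incl ζ).fst +
        inner 𝕜 (D.vPart z : H₂) (D.A.incl ζ).snd) +
      (inner 𝕜 (D.A₁.op (D.uPart z) + D.Chalf (D.wPart z)) (D.A.incl ζ).fst +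
        inner 𝕜 (D.A₂.halfMap (D.wPart z)) (D.A.incl ζ).snd) := by
  have h : D.A.energyShift μ ζ (D.A.ofDomain z) =
      (μ : 𝕜) * inner 𝕜 (z : D.ProdSpace) (D.A.incl ζ) + inner 𝕜 (D.A.ofDomain z) ζ := rfl
  -- All of `A` is put on the test vector, where it is given by its explicit formula.
  have h2 : inner 𝕜 (D.A.ofDomain z) ζ = inner 𝕜 (D.operatorA z) (D.A.incl ζ) :=
    (D.A.inner_op z ζ).symm
  rw [h, h2]
  rfl

/-- If `(μ + A) (ξ, v) = 𝓑₀ u`, then `v = A₂^{1/2} p` with `p = -(μ + A₂)⁻¹ C* ξ`. -/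
lemma snd_eq_of_energyShift_eq {μ : ℝ} (hμ : 0 ≤ μ) {ζ : D.A.Half} {u : U}
    (h : D.A.energyShift μ ζ = D.B₀ u) :
    (D.A.incl ζ).snd = -D.A₂.halfMap (D.A₂.resolvent hμ (D.Cstar (D.halfFst ζ))) := by
  set ξ := D.halfFst ζ with hξ
  set v := (D.A.incl ζ).snd with hv
  obtain ⟨p, hp⟩ := D.A₂.sqrt_surjective v
  -- This is `A₂^{1/2} v = -μ p - C* ξ` in weak form; self-adjointness of `A₂^{1/2}` then yields `v
  -- ∈ D(A₂^{1/2})`.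
  have key : ∀ w : D.A₂.sqrt.domain,
      inner 𝕜 (-((μ : 𝕜) • (p : H₂)) - D.Cstar ξ) (w : H₂) = inner 𝕜 v (D.A₂.sqrt w) := by
    intro w
    -- The test vector is `z = (0, A₂^{-1/2} w)`: it is not seen by `𝓑₀ u`, and `A z = (C w,
    -- A₂^{1/2} w)`.
    obtain ⟨z, hz, hz'⟩ := D.operatorA_solve 0 w
    have hu : D.uPart z = 0 := by
      refine D.A₁.shift_injective le_rfl ?_
      rw [map_zero, PosOp.shift_apply, hz']
      simp
    have hvw : D.A₂.sqrt (D.vPart z) = w := by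
      have := D.incl_wPart z
      rw [hz, hu, map_zero, map_zero, zero_add] at this
      exact this.symm
    have h1 := congrArg (fun f : D.A.NegHalf => f (D.A.ofDomain z)) h
    simp only [energyShift_ofDomain, B₀_apply, halfFst_ofDomain] at h1
    rw [hz, hz', hu, map_zero, map_zero] at h1
    have e1 : inner 𝕜 (D.Chalf w) (D.A.incl ζ).fst = inner 𝕜 (w : H₂) (D.Cstar ξ) := by
      rw [← inner_conj_symm, ← inner_conj_symm (w : H₂)]
      exact congrArg _ (D.inner_Cstar ξ w).symm
    have e2 : inner 𝕜 (D.vPart z : H₂) v = inner 𝕜 (w : H₂) (p : H₂) := by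
      rw [← hp, ← selfAdj_symm D.A₂.sqrt_spec.selfAdj, hvw]
    have h2 : (μ : 𝕜) * inner 𝕜 (w : H₂) (p : H₂) +
        (inner 𝕜 (w : H₂) (D.Cstar ξ) + inner 𝕜 (D.A₂.sqrt w) v) = 0 := by
      rw [← e2, ← e1]
      rw [ZeroMemClass.coe_zero, inner_zero_left, zero_add, zero_add] at h1
      exact h1
    rw [← inner_conj_symm, ← inner_conj_symm v]
    refine congrArg _ ?_
    rw [inner_sub_right, inner_neg_right, inner_smul_right]
    linear_combination -h2
  obtain ⟨hmem, hval⟩ := selfAdj_mem D.A₂.sqrt_spec.selfAdj _ _ key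
  have hmem' : D.A₂.sqrt p ∈ D.A₂.sqrt.domain := by rw [hp]; exact hmem
  have hpA : (p : H₂) ∈ D.A₂.op.domain := (D.A₂.sqrt_spec.mem_iff _).mpr ⟨p.2, hmem'⟩
  have hpv : D.A₂.op ⟨p, hpA⟩ = -((μ : 𝕜) • (p : H₂)) - D.Cstar ξ := by
    rw [← D.A₂.sqrt_sqrt hpA, ← hval]
    exact congrArg _ (Subtype.ext hp)
  -- Now `p ∈ D(A₂)` and `(μ + A₂) p = -C* ξ`.
  have hR : D.A₂.resolvent hμ (D.Cstar ξ) = D.A₂.ofDomain (-⟨p, hpA⟩) := by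
    refine D.A₂.resolvent_eq hμ _ ?_
    rw [LinearPMap.map_neg, hpv, Submodule.coe_neg, smul_neg]
    abel
  rw [hR, map_neg, map_neg, neg_neg]
  exact hp.symm

/-- If `(λ² + A) (ξ, v) = 𝓑₀ u`, then `ξ` solves the reduced equation with right-hand side `B u`. -/
lemma operatorL_halfFst (lam : ℝ) {ζ : D.A.Half} {u : U}
    (h : D.A.energyShift (lam ^ 2) ζ = D.B₀ u) : D.operatorL lam (D.halfFst ζ) = D.B u := by
  have hsnd := D.snd_eq_of_energyShift_eq (sq_nonneg lam) h
  set ξ := D.halfFst ζ with hξ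
  set q := D.A₂.resolvent (sq_nonneg lam) (D.Cstar ξ) with hq
  refine D.A₁.negHalf_ext fun x => ?_
  -- The test vector is `z = (x, -A₂^{-1/2} C* x)`, whose flux vanishes, so that `A z = (A₁ x, 0)`.
  obtain ⟨z, hz, hz'⟩ := D.operatorA_solve (D.A₁.op x) 0
  have hu : D.uPart z = x := by
    refine D.A₁.shift_injective le_rfl ?_
    rw [PosOp.shift_apply, PosOp.shift_apply, hz']
    simp
  have hv : D.A₂.sqrt (D.vPart z) = -D.Cstar (D.A₁.ofDomain x) := by
    have := D.incl_wPart z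
    rw [hz, hu, map_zero] at this
    exact (neg_eq_of_add_eq_zero_right this.symm).symm
  have h1 := congrArg (fun f : D.A.NegHalf => f (D.A.ofDomain z)) h
  simp only [energyShift_ofDomain, B₀_apply, halfFst_ofDomain] at h1
  rw [hz, hu, map_zero, map_zero, add_zero, inner_zero_left, add_zero, hsnd] at h1
  -- The coupling term of `operatorL` comes from the zeroth order term `λ² v`: the factors
  -- `A₂^{1/2}` and `A₂^{-1/2}` cancel, and so do the two signs.
  have e1 : inner 𝕜 (D.vPart z : H₂) (-D.A₂.halfMap q) =
      inner 𝕜 (x : H₁) (D.Chalf q) := by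
    have e2 : inner 𝕜 (D.vPart z : H₂) (D.A₂.halfMap q) =
        inner 𝕜 (D.A₂.sqrt (D.vPart z)) (D.A₂.incl q) :=
      (selfAdj_symm D.A₂.sqrt_spec.selfAdj (D.vPart z) q).symm
    rw [inner_neg_right, e2, hv, inner_neg_left, neg_neg]
    exact D.inner_Cstar _ _
  have e3 : inner 𝕜 (D.A₁.op x) (D.A.incl ζ).fst = D.A₁.energyOp ξ (D.A₁.ofDomain x) :=
    D.A₁.inner_op x ξ
  rw [e1, e3] at h1
  rw [← h1]
  have e4 : D.operatorL lam ξ (D.A₁.ofDomain x) = ((lam ^ 2 : ℝ) : 𝕜) *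
      inner 𝕜 (x : H₁) (D.A.incl ζ).fst + D.A₁.energyOp ξ (D.A₁.ofDomain x) +
      ((lam ^ 2 : ℝ) : 𝕜) * inner 𝕜 (x : H₁) (D.Chalf q) := rfl
  rw [e4]
  ring

lemma adjControl_B₀ (ζ : D.A.Half) : adjControl D.B₀ ζ = adjControl D.B (D.halfFst ζ) := rfl

/-- The first component of `(λ² + A)⁻¹ 𝓑₀ u` solves the reduced equation, whose solution is unique,
and `𝓑₀*` sees only this component. -/
lemma secondOrder_transfer_eq_G (lam : ℝ) :
    SecondOrder.transfer D.B₀ (lam : 𝕜) = D.G lam := by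
  ext1 u
  rw [SecondOrder.transfer_apply, G_apply, adjControl_B₀]
  congr 2
  rw [eq_comm, (D.operatorL_isInvertible lam).inverse_apply_eq, eq_comm]
  exact D.operatorL_halfFst lam
    ((D.A.energyShift_isInvertible (sq_nonneg lam)).self_apply_inverse _)

end CoupledData

end CoupledWave

end

theorem mainTheorem9 {𝕜 : Type*} [RCLike 𝕜] {H₁ H₂ U : Type*}
    [NormedAddCommGroup H₁] [InnerProductSpace 𝕜 H₁] [CompleteSpace H₁]
    [NormedAddCommGroup H₂] [InnerProductSpace 𝕜 H₂] [CompleteSpace H₂]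
    [NormedAddCommGroup U] [InnerProductSpace 𝕜 U] [CompleteSpace U]
    (D : CoupledWave.CoupledData 𝕜 H₁ H₂ U) :
    -- (i) the operator is invertible from `H_{1,1/2}` to `H_{1,-1/2}`
    (∀ lam : ℝ, 0 < lam → (D.operatorL lam).IsInvertible) ∧
    -- (ii) `G` is the transfer function of the coupled system
    (∀ lam : ℝ, 0 < lam →
      (CoupledWave.shifted D.J D.gen (lam : 𝕜)).IsInvertible ∧ D.transfer (lam : 𝕜) = D.G lam) ∧
    -- and of the abstract second order system
    (∀ lam : ℝ, 0 < lam →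
      (CoupledWave.shifted (CoupledWave.SecondOrder.J D.A) (CoupledWave.SecondOrder.gen D.A)
        (lam : 𝕜)).IsInvertible ∧
      CoupledWave.SecondOrder.transfer D.B₀ (lam : 𝕜) = D.G lam) := by
  exact ⟨fun lam _ => D.operatorL_isInvertible lam,
    fun lam _ => ⟨D.shifted_isInvertible lam, D.transfer_eq_G lam⟩,
    fun lam _ => ⟨CoupledWave.SecondOrder.shifted_isInvertible D.A lam,
      D.secondOrder_transfer_eq_G lam⟩⟩
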